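/- Let $d\in\{2,3\}$, let $\Omega\subset\mathbb{R}^d$ be a bounded Lipschitz domain with outward unit normal $n$, let $\bar x\in\partial\Omega$, $\varepsilon_0>0$ and $\Gamma_M=B_{\varepsilon_0}(\bar x)\cap\partial\Omega$. Assume that $B_{\varepsilon_0}(\bar x+\varepsilon_0 e_d)\cap\Omega=\emptyset$ and that $\Gamma_M$ is flat with $n(x)=e_d$ on $\Gamma_M$, i.e. $\Omega\cap B_{\varepsilon_0}(\bar x)=\{x\in B_{\varepsilon_0}(\bar x): e_d\cdot(x-\bar x)<0\}$. Let $\underline g,\overline g\in\mathbb{R}$, and for $C_G\in\mathbb{R}$ let $$G=\{g\in H^1(\partial\Omega):\ \underline g\le g\le\overline g \text{ a.e. on }\partial\Omega,\ \|g\|_{H^1(\partial\Omega)}\le C_G\}.$$ For $i=1,2$ let $a_i:\mathbb{R}\to\mathbb{R}$, $b_i:\Omega\times\mathbb{R}\to\mathbb{R}^d$ and $c_i:\Omega\times\mathbb{R}\times\mathbb{R}^d\to\mathbb{R}$ be (the continuous representatives of) $W^{1,\infty}$ functions with norm bounded by $C_A$, and let $0<\underline a\le a_i\le\overline a$ for some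 constants $\underline a,\overline a$. A weak solution for the datum $g\in G$ is a function $u\in H^1(\Omega)$ with $u=g$ on $\partial\Omega$ in the sense of traces and $$\int_\Omega (a_i(u)\nabla u+b_i(x,u))\cdot\nabla\varphi+c_i(x,u,\nabla u)\,\varphi\,dx=0\qquad\text{for all }\varphi\in H^1_0(\Omega).$$ Assume, for $i=1,2$, that for every $g\in G$ a weak solution exists, and that every weak solution with datum in $G$ satisfies $\|u\|_{H^1(\Omega)}\le C_U$ with a constant $C_U$ independent of $g$. For each $g\in G$ let $u_i(g)$ be a weak solution, and let its Neumann flux $j_i(g)$ be the functional on $H^1(\Omega)$ given by $$\langle j_i(g),\varphi\rangle=\int_\Omega (a_i(u_i)\nabla u_i+b_i(x,u_i))\cdot\nabla\varphi+c_i(x,u_i,\nabla u_i)\,\varphi\,dx,\qquad u_i=u_i(g).$$ We say that $j_1(g)\equiv j_2(g)$ on $\Gamma_M$ if $\langle j_1(g)-j_2(g),\varphi\rangle=0$ for all $\varphi\in H^1(\Omega)$ whose trace vanishes on $\partial\Omega\setminus\Gamma_M$. There is a constant $C_0$, depending only on $d,\Omega,\bar x,\varepsilon_0,\underline g,\overline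 g$, such that the following holds for all $C_G,C_A,C_U$ and all $a_i,b_i,c_i,u_i(\cdot)$ as above. (i) If $C_G\ge C_0$ and $a_1(s)\ne a_2(s)$ for some $s\in(\underline g,\overline g)$, then there is $g\in G$ such that $j_1(g)\not\equiv j_2(g)$ on $\Gamma_M$. (ii) If, for $i=1,2$ and every $g\in G$, the weak solution $u_i(g)$ is unique and satisfies $\underline g\le u_i(g)\le\overline g$ a.e. in $\Omega$, and if $b_1\equiv b_2$ and $c_1\equiv c_2$, then, for any $C_G$, the reverse implication holds: if $j_1(g)\not\equiv j_2(g)$ on $\Gamma_M$ for some $g\in G$, then $a_1(s)\neq a_2(s)$ for some $s\in(\underline g,\overline g)$. -/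

import Mathlib

open MeasureTheory Filter Topology Set Metric
open scoped ENNReal NNReal ContDiff InnerProductSpace

noncomputable section

namespace QuasilinearElliptic

/-- The space `ℝ^d` with `d = n + 1`, with its Euclidean norm. -/
abbrev Space (n : ℕ) : Type := EuclideanSpace ℝ (Fin (n + 1))

/-- The last unit vector `e_d`. -/
def lastUnit (n : ℕ) : Space n := EuclideanSpace.single (Fin.last n) 1

/-! ### Geometry -/

/-- `Ω` is a bounded Lipschitz domain: open, connected, bounded, and near each boundary point it is
the strict subgraph of a Lipschitz function over the hyperplane orthogonal to some unit vector. -/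
structure IsBoundedLipschitzDomain {n : ℕ} (Ω : Set (Space n)) : Prop where
  isOpen : IsOpen Ω
  isConnected : IsConnected Ω
  isBounded : Bornology.IsBounded Ω
  lipschitz_boundary : ∀ p ∈ frontier Ω, ∃ ν : Space n, ‖ν‖ = 1 ∧ ∃ r : ℝ, 0 < r ∧
    ∃ (L : ℝ≥0) (f : ((ℝ ∙ ν)ᗮ : Submodule ℝ (Space n)) → ℝ), LipschitzWith L f ∧
      ∀ x ∈ ball p r, (x ∈ Ω ↔ ⟪ν, x⟫_ℝ < f ((ℝ ∙ ν)ᗮ.orthogonalProjectionOnto x))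

/-- The accessible part `Γ_M = B_{ε₀}(x̄) ∩ ∂Ω` of the boundary. -/
def accessiblePart {n : ℕ} (Ω : Set (Space n)) (xbar : Space n) (ε₀ : ℝ) : Set (Space n) :=
  ball xbar ε₀ ∩ frontier Ω

/-- Exterior ball at `x̄ ∈ ∂Ω`, and flatness of `B_{ε₀}(x̄) ∩ ∂Ω` with outward unit normal `e_d`:
inside `B_{ε₀}(x̄)` the domain is the half ball below the hyperplane through `x̄` orthogonal to
`e_d`. -/
structure IsFlatPart {n : ℕ} (Ω : Set (Space n)) (xbar : Space n) (ε₀ : ℝ) : Prop where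
  mem_frontier : xbar ∈ frontier Ω
  pos : 0 < ε₀
  exterior_ball : ball (xbar + ε₀ • lastUnit n) ε₀ ∩ Ω = ∅
  flat : ∀ x ∈ ball xbar ε₀, (x ∈ Ω ↔ ⟪lastUnit n, x - xbar⟫_ℝ < 0)

/-- The surface measure on `∂Ω`: the `(d-1)`-dimensional Hausdorff measure (normalized so as to agree
with Lebesgue measure on hyperplanes), restricted to `∂Ω`. -/
def surfaceMeasure {n : ℕ} (Ω : Set (Space n)) : Measure (Space n) :=
  (μHE[n] : Measure (Space n)).restrict (frontier Ω)

/-! ### Weak derivatives and Sobolev spaces -/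

/-- `f'` is the weak (distributional) derivative of `f` on the open set `U`. -/
def HasWeakFDeriv {X F : Type*} [NormedAddCommGroup X] [NormedSpace ℝ X] [MeasureSpace X]
    [NormedAddCommGroup F] [NormedSpace ℝ F] (U : Set X) (f : X → F) (f' : X → X →L[ℝ] F) : Prop :=
  ∀ φ : X → ℝ, ContDiff ℝ ∞ φ → HasCompactSupport φ → tsupport φ ⊆ U → ∀ v : X,
    ∫ x in U, fderiv ℝ φ x v • f x = - ∫ x in U, φ x • f' x v

/-- `f` (its continuous representative) lies in `W^{1,∞}(U)`, with `f` and its weak derivative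
bounded by `C`. -/
def IsW1Infty {X F : Type*} [NormedAddCommGroup X] [NormedSpace ℝ X] [MeasureSpace X]
    [NormedAddCommGroup F] [NormedSpace ℝ F] (U : Set X) (f : X → F) (C : ℝ) : Prop :=
  ContinuousOn f U ∧ (∀ x ∈ U, ‖f x‖ ≤ C) ∧
    ∃ f' : X → X →L[ℝ] F, AEStronglyMeasurable f' (volume.restrict U) ∧
      (∀ᵐ x ∂(volume.restrict U), ‖f' x‖ ≤ C) ∧ HasWeakFDeriv U f f'

/-- An element of `H¹(Ω)`: an `L²` function together with its weak gradient in `L²`. -/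
structure SobolevH1 {n : ℕ} (Ω : Set (Space n)) where
  toFun : Space n → ℝ
  grad : Space n → Space n
  memLp_toFun : MemLp toFun 2 (volume.restrict Ω)
  memLp_grad : MemLp grad 2 (volume.restrict Ω)
  hasWeakGrad : HasWeakFDeriv Ω toFun (fun x => innerSL ℝ (grad x))

/-- The norm of `H¹(Ω)`. -/
def SobolevH1.norm {n : ℕ} {Ω : Set (Space n)} (u : SobolevH1 Ω) : ℝ :=
  √(∫ x in Ω, (u.toFun x ^ 2 + ‖u.grad x‖ ^ 2))

/-- The differentiable functions `ψ k` converge to `u` in `H¹(Ω)`. -/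
def TendstoH1 {n : ℕ} {Ω : Set (Space n)} (ψ : ℕ → Space n → ℝ) (u : SobolevH1 Ω) : Prop :=
  Tendsto (fun k => eLpNorm (fun x => ψ k x - u.toFun x) 2 (volume.restrict Ω)) atTop (𝓝 0) ∧
  Tendsto (fun k => eLpNorm (fun x => gradient (ψ k) x - u.grad x) 2 (volume.restrict Ω))
    atTop (𝓝 0)

/-- `φ ∈ H¹₀(Ω)`, the closure of `C_c^∞(Ω)` in `H¹(Ω)`. -/
def MemH10 {n : ℕ} {Ω : Set (Space n)} (φ : SobolevH1 Ω) : Prop :=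
  ∃ ψ : ℕ → Space n → ℝ,
    (∀ k, ContDiff ℝ ∞ (ψ k) ∧ HasCompactSupport (ψ k) ∧ tsupport (ψ k) ⊆ Ω) ∧ TendstoH1 ψ φ

/-- `g ∈ L²(∂Ω)` is the trace of `u ∈ H¹(Ω)`: the trace operator is the continuous extension to
`H¹(Ω)` of the restriction to `∂Ω` of functions smooth up to the boundary. -/
def HasTrace {n : ℕ} {Ω : Set (Space n)} (u : SobolevH1 Ω) (g : Space n → ℝ) : Prop :=
  MemLp g 2 (surfaceMeasure Ω) ∧
  ∃ ψ : ℕ → Space n → ℝ, (∀ k, ContDiff ℝ ∞ (ψ k)) ∧ TendstoH1 ψ u ∧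
    Tendsto (fun k => eLpNorm (fun x => ψ k x - g x) 2 (surfaceMeasure Ω)) atTop (𝓝 0)

/-- The tangential gradient on `∂Ω` of a smooth function `ψ` on `ℝ^d`: the projection of `∇ψ` to the
tangent space of `∂Ω`, which exists at almost every point of a Lipschitz boundary. -/
def tangentialGradient {n : ℕ} (Ω : Set (Space n)) (ψ : Space n → ℝ) (x : Space n) : Space n :=
  (Submodule.span ℝ (tangentConeAt ℝ (frontier Ω) x)).starProjection (gradient ψ x)

/-- The `H¹(∂Ω)` norm of the restriction to `∂Ω` of a smooth function on `ℝ^d`. -/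
def smoothBoundaryH1Norm {n : ℕ} (Ω : Set (Space n)) (ψ : Space n → ℝ) : ℝ≥0∞ :=
  (∫⁻ x, (‖ψ x‖ₑ ^ 2 + ‖tangentialGradient Ω ψ x‖ₑ ^ 2) ∂(surfaceMeasure Ω)) ^ (1 / 2 : ℝ)

/-- `g ∈ H¹(∂Ω)` with norm `N`, where `H¹(∂Ω)` is the completion of the restrictions to `∂Ω` of smooth
functions on `ℝ^d` under the `H¹(∂Ω)` norm, regarded as a subspace of `L²(∂Ω)`. -/
def HasBoundaryH1Norm {n : ℕ} (Ω : Set (Space n)) (g : Space n → ℝ) (N : ℝ≥0∞) : Prop :=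
  MemLp g 2 (surfaceMeasure Ω) ∧
  ∃ ψ : ℕ → Space n → ℝ, (∀ k, ContDiff ℝ ∞ (ψ k)) ∧
    Tendsto (fun k => eLpNorm (fun x => ψ k x - g x) 2 (surfaceMeasure Ω)) atTop (𝓝 0) ∧
    Tendsto (fun p : ℕ × ℕ => smoothBoundaryH1Norm Ω (fun x => ψ p.1 x - ψ p.2 x)) atTop (𝓝 0) ∧
    Tendsto (fun k => smoothBoundaryH1Norm Ω (ψ k)) atTop (𝓝 N)

/-- The class `G` of Dirichlet data: `g ∈ H¹(∂Ω)` with `g_low ≤ g ≤ g_up` almost everywhere on `∂Ω`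
and `‖g‖_{H¹(∂Ω)} ≤ C_G`. -/
def dirichletClass {n : ℕ} (Ω : Set (Space n)) (g_low g_up C_G : ℝ) : Set (Space n → ℝ) :=
  {g | (∃ N : ℝ≥0∞, HasBoundaryH1Norm Ω g N ∧ N ≤ ENNReal.ofReal C_G) ∧
    ∀ᵐ x ∂(surfaceMeasure Ω), g_low ≤ g x ∧ g x ≤ g_up}

/-! ### The quasilinear elliptic problem -/

/-- The coefficient functions of `-div (a(u) ∇u + b(x,u)) + c(x,u,∇u) = 0`. -/
structure Coefficients (n : ℕ) where
  a : ℝ → ℝ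
  b : Space n → ℝ → Space n
  c : Space n → ℝ → Space n → ℝ

/-- The coefficients lie in `W^{1,∞}` with norm bounded by `C_A`, and `a` is bounded from below and
above by positive constants. -/
structure Coefficients.IsAdmissible {n : ℕ} (P : Coefficients n) (Ω : Set (Space n)) (C_A : ℝ) :
    Prop where
  a_mem : IsW1Infty univ P.a C_A
  b_mem : IsW1Infty (Ω ×ˢ univ) (fun p : Space n × ℝ => P.b p.1 p.2) C_A
  c_mem : IsW1Infty (Ω ×ˢ univ) (fun p : Space n × (ℝ × Space n) => P.c p.1 p.2.1 p.2.2) C_A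
  a_bounds : ∃ a_low a_up : ℝ, 0 < a_low ∧ 0 < a_up ∧ ∀ s, a_low ≤ P.a s ∧ P.a s ≤ a_up

/-- The form `(a(u) ∇u + b(x,u), ∇φ)_Ω + (c(x,u,∇u), φ)_Ω`. For a weak solution `u` this is, as a
functional of `φ ∈ H¹(Ω)`, the Neumann flux `⟨j, φ⟩_{∂Ω}`. -/
def Coefficients.flux {n : ℕ} (P : Coefficients n) {Ω : Set (Space n)} (u φ : SobolevH1 Ω) : ℝ :=
  ∫ x in Ω, (⟪P.a (u.toFun x) • u.grad x + P.b x (u.toFun x), φ.grad x⟫_ℝ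
    + P.c x (u.toFun x) (u.grad x) * φ.toFun x)

/-- `u ∈ H¹(Ω)` is a weak solution of the Dirichlet problem with boundary values `g`. -/
def Coefficients.IsWeakSolution {n : ℕ} (P : Coefficients n) {Ω : Set (Space n)}
    (u : SobolevH1 Ω) (g : Space n → ℝ) : Prop :=
  HasTrace u g ∧ ∀ φ : SobolevH1 Ω, MemH10 φ → P.flux u φ = 0

/-- For each Dirichlet datum in the class there is a weak solution, and every weak solution is bounded
by `C_U` in `H¹(Ω)`. -/
def Coefficients.IsUniformlySolvable {n : ℕ} (P : Coefficients n) (Ω : Set (Space n))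
    (G : Set (Space n → ℝ)) (C_U : ℝ) : Prop :=
  ∀ g ∈ G, (∃ u : SobolevH1 Ω, P.IsWeakSolution u g) ∧
    ∀ u : SobolevH1 Ω, P.IsWeakSolution u g → u.norm ≤ C_U

/-- Weak solutions are unique (almost everywhere in `Ω`) for each Dirichlet datum in the class. -/
def Coefficients.IsUniquelySolvable {n : ℕ} (P : Coefficients n) (Ω : Set (Space n))
    (G : Set (Space n → ℝ)) : Prop :=
  ∀ g ∈ G, ∀ u v : SobolevH1 Ω, P.IsWeakSolution u g → P.IsWeakSolution v g →
    u.toFun =ᵐ[volume.restrict Ω] v.toFun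

/-- `j₁ ≡ j₂` on the part `Γ` of `∂Ω`, for functionals on `H¹(Ω)`: they agree on all `φ ∈ H¹(Ω)` with
`φ = 0` on `∂Ω \ Γ` in the sense of traces. -/
def FluxesAgreeOn {n : ℕ} {Ω : Set (Space n)} (Γ : Set (Space n)) (j₁ j₂ : SobolevH1 Ω → ℝ) : Prop :=
  ∀ (φ : SobolevH1 Ω) (h : Space n → ℝ), HasTrace φ h →
    (∀ᵐ x ∂(surfaceMeasure Ω), x ∉ Γ → h x = 0) → j₁ φ = j₂ φ

end QuasilinearElliptic

end

open QuasilinearElliptic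

/-!
The first assertion rests on testing the equations with functions that are singular at the boundary
point `x̄`. Suppose that all fluxes agree, let `a₁ s ≠ a₂ s`, and let `A_i` be the primitive of `a_i`
with `A_i s = 0`. Since `b_i` and `c_i` are bounded and `a_i(u_i) ∇u_i = ∇(A_i(u_i))`, the difference
of the fluxes at a test function `φ` supported in `B_{ε₀}(x̄)` is, up to `O(‖φ‖_{W^{1,1}})`, equal to
`∫ ∇(A₁(u₁) - A₂(u₂)) · ∇φ`. By Green's formula (`integral_primitive_of_hasTrace`) this is the boundary
integral of `(A₁(g) - A₂(g)) ∂_d φ` minus the volume integral of `(A₁(u₁) - A₂(u₂)) Δφ`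
(`Coefficients.IsAdmissible.abs_flux_sub_boundary_le`). The identity holds for functions smooth up to
the boundary, by the divergence theorem in a half space, and passes to the limit.

For `φ` one takes a cut-off of the harmonic dipole `y_d |y|^{-d}` with pole `x̄ + δ e_d`, outside `Ω`
(`exists_testFunction`). As the dipole is harmonic, `Δφ` is bounded independently of `δ`, so that its
contribution stays bounded. The `W^{1,1}` norm is `O(δ^{-1/4})` (in fact logarithmic), while
`∂_d φ ≤ -c δ^{-d}` on the boundary within distance `δ/2` of `x̄`. For `g` one takes a bump over `s` of
width `δ` and height `κ √δ`, small enough that its `H¹(∂Ω)` norm stays below a constant depending only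
on the geometry and on the bounds for `g` (`exists_datum`). As `A₁ - A₂` vanishes at `s` and has
nonzero derivative there, the boundary integral has size at least a constant times `δ^{-1/2}`, which
is a contradiction as `δ → 0` (`exists_not_fluxesAgreeOn`).

For the second assertion, if `a₁ = a₂` on `(g_low, g_up)`, then equality holds on the closed interval,
in which `u₁` takes its values, so `u₁` solves the second problem and coincides with `u₂` by uniqueness
(`exists_ne_of_not_fluxesAgreeOn`). If `g_low = g_up`, the open interval is empty, but then `u₁` is
constant and the principal part vanishes.
-/

open QuasilinearElliptic

noncomputable section

namespace QuasilinearElliptic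

variable {n : ℕ} {Ω : Set (Space n)} {xbar : Space n} {ε₀ : ℝ}

/-! ### The boundary of a Lipschitz domain and its surface measure -/

theorem inner_lastUnit (x : Space n) : ⟪lastUnit n, x⟫_ℝ = x (Fin.last n) := by
  simp [lastUnit, EuclideanSpace.inner_single_left]

theorem norm_lastUnit : ‖lastUnit n‖ = 1 := by
  simp [lastUnit]

/-- An open set which inside `B` is the sublevel set `F < 0` has its boundary points in `B` on the level
set `F = 0`. -/
theorem frontier_inter_ball_graph {E : Type*} [TopologicalSpace E]
    {U B : Set E} (hU : IsOpen U) (hB : IsOpen B) {F : E → ℝ} (hF : Continuous F)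
    (h : ∀ x ∈ B, (x ∈ U ↔ F x < 0)) {x : E} (hx : x ∈ frontier U) (hxB : x ∈ B) : F x = 0 := by
  rw [hU.frontier_eq] at hx
  refine le_antisymm ?_ (not_lt.1 fun hlt => hx.2 ((h x hxB).2 hlt))
  by_contra hpos
  push Not at hpos
  have hopen : IsOpen (B ∩ F ⁻¹' Ioi 0) := hB.inter (isOpen_Ioi.preimage hF)
  obtain ⟨y, ⟨hyB, hy⟩, hyU⟩ := mem_closure_iff.1 hx.1 _ hopen ⟨hxB, hpos⟩
  exact absurd ((h y hyB).1 hyU) (not_lt.2 (le_of_lt hy))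

/-- The boundary of a bounded Lipschitz domain has finite surface measure: it is covered by finitely
many Lipschitz images of bounded subsets of hyperplanes. -/
theorem surfaceMeasure_frontier_lt_top (hΩ : IsBoundedLipschitzDomain Ω) :
    (μHE[n] : Measure (Space n)) (frontier Ω) < ⊤ := by
  have hcomp : IsCompact (frontier Ω) :=
    (hΩ.isBounded.isCompact_closure).of_isClosed_subset isClosed_frontier frontier_subset_closure
  refine hcomp.measure_lt_top_of_nhdsWithin fun p hp => ?_
  obtain ⟨ν, hν, r, hr, hgraph⟩ := hΩ.lipschitz_boundary p hp
  set K : Submodule ℝ (Space n) := (ℝ ∙ ν)ᗮ with hK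
  obtain ⟨L, f, hf, hΩf⟩ := hgraph
  let Ψ : K → Space n := fun k => (k : Space n) + f k • ν
  have hΨ : LipschitzWith (1 + L) Ψ := by
    refine LipschitzWith.add K.subtypeₗᵢ.lipschitz (LipschitzWith.of_dist_le_mul fun x y => ?_)
    rw [dist_eq_norm, ← sub_smul, norm_smul, hν, mul_one, ← dist_eq_norm]
    exact hf.dist_le_mul x y
  refine ⟨frontier Ω ∩ ball p r,
    inter_mem self_mem_nhdsWithin (mem_nhdsWithin_of_mem_nhds (ball_mem_nhds p hr)), ?_⟩
  have hsub : frontier Ω ∩ ball p r ⊆ Ψ '' ball (K.orthogonalProjectionOnto p) r := by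
    rintro x ⟨hx, hxb⟩
    have hcont : Continuous fun x : Space n => ⟪ν, x⟫_ℝ - f (K.orthogonalProjectionOnto x) :=
      (continuous_const.inner continuous_id).sub
        (hf.continuous.comp K.orthogonalProjectionOnto.continuous)
    have h0 := frontier_inter_ball_graph hΩ.isOpen isOpen_ball hcont
      (fun x hx => by rw [hΩf x hx, sub_neg]) hx hxb
    refine ⟨K.orthogonalProjectionOnto x, ?_, ?_⟩
    · rw [mem_ball, dist_eq_norm, ← map_sub]
      refine (K.norm_orthogonalProjectionOnto_apply_le _).trans_lt ?_
      rwa [← dist_eq_norm]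
    · have h1 := (ℝ ∙ ν).starProjection_add_starProjection_orthogonal x
      rw [Submodule.starProjection_unit_singleton ℝ hν] at h1
      simp only [Ψ]
      rw [← sub_eq_zero.1 h0, add_comm]
      exact h1
  refine (measure_mono hsub).trans_lt ?_
  have hfin : Module.finrank ℝ K = n := by
    have : Fact (Module.finrank ℝ (Space n) = n + 1) := ⟨by simp⟩
    exact Submodule.finrank_orthogonal_span_singleton (by rintro rfl; simp at hν)
  rw [Measure.euclideanHausdorffMeasure_def, Measure.smul_apply]
  refine ENNReal.mul_lt_top ENNReal.coe_lt_top ?_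
  refine (hΨ.hausdorffMeasure_image_le (Nat.cast_nonneg n) _).trans_lt ?_
  refine ENNReal.mul_lt_top (by simp) ?_
  have hH : (μH[(Module.finrank ℝ K : ℝ)] : Measure K).IsAddHaarMeasure :=
    isAddHaarMeasure_hausdorffMeasure
  rw [hfin] at hH
  exact measure_ball_lt_top

theorem isFiniteMeasure_surfaceMeasure (hΩ : IsBoundedLipschitzDomain Ω) :
    IsFiniteMeasure (surfaceMeasure Ω) :=
  ⟨by rw [surfaceMeasure, Measure.restrict_apply_univ]; exact surfaceMeasure_frontier_lt_top hΩ⟩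

theorem isFiniteMeasure_restrict (hΩ : IsBoundedLipschitzDomain Ω) :
    IsFiniteMeasure (volume.restrict Ω) :=
  ⟨by rw [Measure.restrict_apply_univ]; exact hΩ.isBounded.measure_lt_top⟩

/-- The embedding `y ↦ (y, 0)` of `ℝⁿ` into `ℝⁿ⁺¹`. -/
def hyperplaneEmbed (n : ℕ) (y : EuclideanSpace ℝ (Fin n)) : Space n :=
  WithLp.toLp 2 (Fin.snoc (α := fun _ => ℝ) y 0)

theorem hyperplaneEmbed_zero : hyperplaneEmbed n 0 = 0 := by
  ext i
  refine Fin.lastCases ?_ (fun i => ?_) i <;> simp [hyperplaneEmbed]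

theorem hyperplaneEmbed_last (y : EuclideanSpace ℝ (Fin n)) :
    hyperplaneEmbed n y (Fin.last n) = 0 := by
  simp [hyperplaneEmbed]

theorem isometry_hyperplaneEmbed : Isometry (hyperplaneEmbed n) := by
  refine Isometry.of_dist_eq fun x y => ?_
  rw [EuclideanSpace.dist_eq, EuclideanSpace.dist_eq, Fin.sum_univ_castSucc]
  simp [hyperplaneEmbed]

theorem range_hyperplaneEmbed :
    range (hyperplaneEmbed n) = {x : Space n | x (Fin.last n) = 0} := by
  ext x
  constructor
  · rintro ⟨y, rfl⟩
    exact hyperplaneEmbed_last y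
  · intro hx
    refine ⟨WithLp.toLp 2 fun i => x i.castSucc, ?_⟩
    ext i
    refine Fin.lastCases ?_ (fun i => ?_) i
    · rw [hyperplaneEmbed_last]; exact hx.symm
    · simp [hyperplaneEmbed]

theorem frontier_inter_ball (hΩ : IsBoundedLipschitzDomain Ω) (hflat : IsFlatPart Ω xbar ε₀) :
    frontier Ω ∩ ball xbar ε₀ =
      range (fun y => xbar + hyperplaneEmbed n y) ∩ ball xbar ε₀ := by
  ext x
  refine and_congr_left fun hxb => ?_
  have hr : x ∈ range (fun y => xbar + hyperplaneEmbed n y) ↔ ⟪lastUnit n, x - xbar⟫_ℝ = 0 := by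
    have : x ∈ range (fun y => xbar + hyperplaneEmbed n y) ↔
        x - xbar ∈ range (hyperplaneEmbed n) := by
      simp only [mem_range, eq_sub_iff_add_eq, add_comm]
    rw [this, range_hyperplaneEmbed, inner_lastUnit, mem_ofPred_eq]
  rw [hr]
  have hcont : Continuous fun x : Space n => ⟪lastUnit n, x - xbar⟫_ℝ := by fun_prop
  refine ⟨fun hx => frontier_inter_ball_graph hΩ.isOpen isOpen_ball hcont hflat.flat hx hxb,
    fun h0 => ?_⟩
  rw [hΩ.isOpen.frontier_eq]
  refine ⟨mem_closure_iff_seq_limit.2 ?_, fun hx => ((hflat.flat x hxb).1 hx).ne h0⟩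
  have hlim : Tendsto (fun k : ℕ => x - (1 / ((k : ℝ) + 1)) • lastUnit n) atTop (𝓝 x) := by
    have := (tendsto_one_div_add_atTop_nhds_zero_nat (𝕜 := ℝ)).smul_const (lastUnit n)
    simpa using tendsto_const_nhds (x := x) |>.sub this
  obtain ⟨N, hN⟩ := eventually_atTop.1 (hlim.eventually (isOpen_ball.mem_nhds hxb))
  refine ⟨fun k => x - (1 / (((k + N : ℕ) : ℝ) + 1)) • lastUnit n, fun k => ?_,
    hlim.comp (tendsto_add_atTop_nat N)⟩
  rw [hflat.flat _ (hN _ (Nat.le_add_left _ _)), sub_right_comm, inner_sub_right, h0,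
    inner_smul_right, real_inner_self_eq_norm_sq, norm_lastUnit]
  have : (0 : ℝ) < 1 / (((k + N : ℕ) : ℝ) + 1) := by positivity
  linarith

theorem isometry_add_hyperplaneEmbed (xbar : Space n) :
    Isometry (fun y => xbar + hyperplaneEmbed n y) :=
  (isometry_add_left xbar).comp isometry_hyperplaneEmbed

/-- In `B_{ε₀}(x̄)` the surface measure is the image of Lebesgue measure on `ℝⁿ` under
`y ↦ x̄ + (y, 0)`. -/
theorem surfaceMeasure_restrict_ball (hΩ : IsBoundedLipschitzDomain Ω)
    (hflat : IsFlatPart Ω xbar ε₀) :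
    (surfaceMeasure Ω).restrict (ball xbar ε₀) =
      ((volume : Measure (EuclideanSpace ℝ (Fin n))).map
        (fun y => xbar + hyperplaneEmbed n y)).restrict (ball xbar ε₀) := by
  have hj := isometry_add_hyperplaneEmbed xbar
  rw [← EuclideanSpace.euclideanHausdorffMeasure_eq_volume, hj.map_euclideanHausdorffMeasure,
    surfaceMeasure, Measure.restrict_restrict measurableSet_ball,
    Measure.restrict_restrict measurableSet_ball, inter_comm, frontier_inter_ball hΩ hflat,
    inter_comm]

/-- On the flat part, the surface integral is a Lebesgue integral over `ℝⁿ`. -/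
theorem integral_surfaceMeasure (hΩ : IsBoundedLipschitzDomain Ω) (hflat : IsFlatPart Ω xbar ε₀)
    {f : Space n → ℝ} (hf : ∀ x ∉ ball xbar ε₀, f x = 0) :
    ∫ x, f x ∂(surfaceMeasure Ω) = ∫ y, f (xbar + hyperplaneEmbed n y) := by
  have hj := isometry_add_hyperplaneEmbed xbar
  rw [← setIntegral_eq_integral_of_forall_compl_eq_zero hf,
    surfaceMeasure_restrict_ball hΩ hflat, setIntegral_eq_integral_of_forall_compl_eq_zero hf,
    hj.isClosedEmbedding.measurableEmbedding.integral_map]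

theorem surfaceMeasure_ball (hΩ : IsBoundedLipschitzDomain Ω) (hflat : IsFlatPart Ω xbar ε₀)
    {ρ : ℝ} (hρ : ρ ≤ ε₀) :
    surfaceMeasure Ω (ball xbar ρ) = volume (ball (0 : EuclideanSpace ℝ (Fin n)) ρ) := by
  have hj := isometry_add_hyperplaneEmbed xbar
  have hsub : ball xbar ρ ⊆ ball xbar ε₀ := ball_subset_ball hρ
  rw [← Measure.restrict_eq_self _ hsub, surfaceMeasure_restrict_ball hΩ hflat,
    Measure.restrict_eq_self _ hsub, hj.isClosedEmbedding.measurableEmbedding.map_apply]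
  congr 1
  have := hj.preimage_ball 0 ρ
  simpa [hyperplaneEmbed_zero] using this

/-! ### The divergence theorem near the flat part of the boundary -/

/-- The divergence of a vector field on `ℝⁿ⁺¹`. -/
def divergence (V : Space n → Space n) (x : Space n) : ℝ :=
  ∑ i, fderiv ℝ V x (EuclideanSpace.single i 1) i

theorem divergence_of_notMem_tsupport {V : Space n → Space n} {x : Space n} (hx : x ∉ tsupport V) :
    divergence V x = 0 := by
  have : fderiv ℝ V x = 0 := by
    by_contra h
    exact hx (support_fderiv_subset ℝ h)
  simp [divergence, this]

theorem continuous_divergence {V : Space n → Space n} (hV : ContDiff ℝ 1 V) :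
    Continuous (divergence V) := by
  have := hV.continuous_fderiv one_ne_zero
  unfold divergence
  fun_prop

/-- The divergence theorem in the half space `x_d < 0`, obtained from the one in a box whose only face
meeting the support of the field lies in `x_d = 0`. -/
theorem integral_divergence_halfSpace {V : Space n → Space n} (hV : ContDiff ℝ 1 V)
    (hVc : HasCompactSupport V) :
    ∫ x in {x : Space n | x (Fin.last n) < 0}, divergence V x =
      ∫ y, V (hyperplaneEmbed n y) (Fin.last n) := by
  obtain ⟨R, hR, hsupp⟩ : ∃ R : ℝ, 0 < R ∧ ∀ x : Space n, R ≤ ‖x‖ → x ∉ tsupport V := by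
    obtain ⟨R, hR⟩ := hVc.isCompact.isBounded.subset_ball 0
    refine ⟨max R 1, by positivity, fun x hx hxV => ?_⟩
    have := mem_ball_zero_iff.1 (hR hxV)
    exact absurd hx (not_le.2 (this.trans_le (le_max_left _ _)))
  have hV0 : ∀ x : Space n, R ≤ ‖x‖ → V x = 0 := fun x hx =>
    image_eq_zero_of_notMem_tsupport (hsupp x hx)
  have hnorm : ∀ (x : Fin (n + 1) → ℝ) (i : Fin (n + 1)), R ≤ |x i| →
      R ≤ ‖(WithLp.toLp 2 x : Space n)‖ := fun x i h =>
    h.trans (by simpa using PiLp.norm_apply_le (WithLp.toLp 2 x : Space n) i)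
  let a : Fin (n + 1) → ℝ := fun _ => -R
  let b : Fin (n + 1) → ℝ := Fin.snoc (α := fun _ => ℝ) (fun _ => R) 0
  have hblast : b (Fin.last n) = 0 := by simp [b]
  have hbcast : ∀ i : Fin n, b i.castSucc = R := fun i => by simp [b]
  have hab : a ≤ b := fun i => by
    refine Fin.lastCases ?_ (fun i => ?_) i
    · rw [hblast]; simp [a, hR.le]
    · rw [hbcast]; simp only [a]; linarith
  let T : (Fin (n + 1) → ℝ) →L[ℝ] Space n :=
    (PiLp.continuousLinearEquiv 2 ℝ (fun _ : Fin (n + 1) => ℝ)).symm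
  have hT : ∀ x, T x = WithLp.toLp 2 x := fun x => rfl
  let f : Fin (n + 1) → (Fin (n + 1) → ℝ) → ℝ := fun i x => V (WithLp.toLp 2 x) i
  let f' : Fin (n + 1) → (Fin (n + 1) → ℝ) → ((Fin (n + 1) → ℝ) →L[ℝ] ℝ) := fun i x =>
    (EuclideanSpace.proj i : Space n →L[ℝ] ℝ) ∘L (fderiv ℝ V (WithLp.toLp 2 x) ∘L T)
  have hff' : ∀ x i, HasFDerivAt (f i) (f' i x) x := fun x i => by
    have h1 : HasFDerivAt V (fderiv ℝ V (T x)) (T x) :=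
      (hV.differentiable one_ne_zero).differentiableAt.hasFDerivAt
    exact (EuclideanSpace.proj i : Space n →L[ℝ] ℝ).hasFDerivAt.comp x (h1.comp x T.hasFDerivAt)
  have hdiv : ∀ x, ∑ i, f' i x (Pi.single i 1) = divergence V (WithLp.toLp 2 x) := fun x => by
    simp only [divergence, f', ContinuousLinearMap.comp_apply, hT]
    rfl
  have hcont : Continuous fun x : Fin (n + 1) → ℝ => divergence V (WithLp.toLp 2 x) :=
    (continuous_divergence hV).comp T.continuous
  have key := integral_divergence_of_hasFDerivAt_off_countable' a b hab f f' ∅ countable_empty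
    (fun i => (continuous_iff_continuousAt.2 fun x => (hff' x i).continuousAt).continuousOn)
    (fun x _ i => hff' x i)
    (by simp_rw [hdiv]; exact hcont.continuousOn.integrableOn_compact isCompact_Icc)
  simp_rw [hdiv] at key
  have hMP := PiLp.volume_preserving_toLp (Fin (n + 1))
  have hME : MeasurableEmbedding (WithLp.toLp 2 : (Fin (n + 1) → ℝ) → Space n) :=
    (MeasurableEquiv.toLp 2 (Fin (n + 1) → ℝ)).measurableEmbedding
  have hmeas : MeasurableSet {x : Fin (n + 1) → ℝ | x (Fin.last n) ≤ 0} :=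
    measurableSet_le (measurable_pi_apply _) measurable_const
  have hL : ∫ x in {x : Space n | x (Fin.last n) < 0}, divergence V x =
      ∫ x in Icc a b, divergence V (WithLp.toLp 2 x) := by
    rw [← hMP.setIntegral_preimage_emb hME]
    have h1 : (WithLp.toLp 2 ⁻¹' {x : Space n | x (Fin.last n) < 0} : Set (Fin (n + 1) → ℝ))
        =ᵐ[volume] {x : Fin (n + 1) → ℝ | x (Fin.last n) ≤ 0} := by
      have h0 : (volume : Measure (Fin (n + 1) → ℝ)) {x | x (Fin.last n) = 0} = 0 :=
        Measure.pi_hyperplane _ _ _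
      filter_upwards [measure_eq_zero_iff_ae_notMem.1 h0] with x hx
      refine propext ⟨fun h => le_of_lt h, fun h => lt_of_le_of_ne h hx⟩
    rw [setIntegral_congr_set h1]
    refine setIntegral_eq_of_subset_of_forall_sdiff_eq_zero hmeas (fun x hx => ?_) (fun x hx => ?_)
    · have := hx.2 (Fin.last n)
      rwa [hblast] at this
    · refine divergence_of_notMem_tsupport (hsupp _ ?_)
      by_contra hlt
      refine hx.2 ⟨fun i => ?_, fun i => ?_⟩
      · by_contra h
        refine hlt (hnorm x i ?_)
        simp only [a, not_le] at h
        rw [abs_of_neg (by linarith)]; linarith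
      · refine Fin.lastCases ?_ (fun i => ?_) i
        · rw [hblast]; exact hx.1
        · rw [hbcast]
          by_contra h
          refine hlt (hnorm x i.castSucc ?_)
          exact (not_le.1 h).le.trans (le_abs_self _)
  rw [hL, key, Fin.sum_univ_castSucc]
  -- The field vanishes on all faces of the box at distance `R` from the origin.
  have hside : ∀ (i : Fin (n + 1)) (t : ℝ) (x : Fin n → ℝ), R ≤ |t| →
      f i (i.insertNth t x) = 0 := fun i t x ht => by
    simp only [f]
    rw [hV0 _ (hnorm _ i (by simpa using ht))]
    rfl
  rw [Finset.sum_eq_zero, zero_add]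
  · have h2 : ∀ x, f (Fin.last n) ((Fin.last n).insertNth (a (Fin.last n)) x) = 0 := fun x =>
      hside _ _ _ (by simp [a, abs_of_pos hR])
    simp only [h2, integral_zero, sub_zero, hblast]
    rw [setIntegral_eq_integral_of_forall_compl_eq_zero]
    · rw [← (PiLp.volume_preserving_toLp (Fin n)).integral_comp
        (MeasurableEquiv.toLp 2 (Fin n → ℝ)).measurableEmbedding]
      refine integral_congr_ae (Eventually.of_forall fun x => ?_)
      simp only [f, hyperplaneEmbed]
      rw [Fin.insertNth_last']
    · intro x hx
      simp only [f]
      rw [hV0]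
      · rfl
      by_contra hlt
      refine hx ⟨fun i => ?_, fun i => ?_⟩
      · by_contra h
        refine hlt (hnorm _ i.castSucc ?_)
        simp only [a, Function.comp, not_le] at h
        simp only [Fin.insertNth_last', Fin.snoc_castSucc]
        rw [abs_of_neg (by linarith)]; linarith
      · by_contra h
        refine hlt (hnorm _ i.castSucc ?_)
        simp only [Function.comp, not_le, Fin.succAbove_last, hbcast] at h
        simp only [Fin.insertNth_last', Fin.snoc_castSucc]
        exact h.le.trans (le_abs_self _)
  · intro i _
    have h1 : ∀ x, f i.castSucc (i.castSucc.insertNth (b i.castSucc) x) = 0 := fun x =>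
      hside _ _ _ (by simp [hbcast, abs_of_pos hR])
    have h2 : ∀ x, f i.castSucc (i.castSucc.insertNth (a i.castSucc) x) = 0 := fun x =>
      hside _ _ _ (by simp [a, abs_of_pos hR])
    simp [h1, h2]

/-- The divergence theorem for fields supported near the flat part of the boundary. -/
theorem integral_divergence (hΩ : IsBoundedLipschitzDomain Ω) (hflat : IsFlatPart Ω xbar ε₀)
    {V : Space n → Space n} (hV : ContDiff ℝ 1 V) (hVs : tsupport V ⊆ ball xbar ε₀) :
    ∫ x in Ω, divergence V x = ∫ x, ⟪lastUnit n, V x⟫_ℝ ∂(surfaceMeasure Ω) := by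
  have hVc : HasCompactSupport V :=
    IsCompact.of_isClosed_subset (isCompact_closedBall xbar ε₀) (isClosed_tsupport V)
      (hVs.trans ball_subset_closedBall)
  have hdiv0 : ∀ x ∉ ball xbar ε₀, divergence V x = 0 := fun x hx =>
    divergence_of_notMem_tsupport fun h => hx (hVs h)
  rw [integral_surfaceMeasure hΩ hflat (fun x hx => by
    rw [image_eq_zero_of_notMem_tsupport fun h => hx (hVs h), inner_zero_right])]
  simp_rw [inner_lastUnit]
  have hW : ContDiff ℝ 1 fun x => V (xbar + x) := hV.comp (contDiff_const.add contDiff_id)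
  have hWc : HasCompactSupport fun x => V (xbar + x) :=
    hVc.comp_homeomorph (Homeomorph.addLeft xbar)
  rw [← integral_divergence_halfSpace hW hWc]
  have hdW : ∀ x, divergence (fun x => V (xbar + x)) x = divergence V (xbar + x) := fun x => by
    simp only [divergence, fderiv_comp_add_left]
  simp_rw [hdW]
  rw [← integral_indicator hΩ.isOpen.measurableSet, ← integral_indicator (by
    exact measurableSet_lt (by fun_prop) measurable_const),
    ← integral_add_left_eq_self _ xbar]
  refine integral_congr_ae (Eventually.of_forall fun x => ?_)
  by_cases hx : xbar + x ∈ ball xbar ε₀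
  · have := hflat.flat _ hx
    rw [inner_lastUnit, add_sub_cancel_left] at this
    by_cases hxΩ : xbar + x ∈ Ω
    · simp only [indicator_of_mem hxΩ]
      rw [indicator_of_mem (show x ∈ {x : Space n | x (Fin.last n) < 0} from this.1 hxΩ)]
    · simp only [indicator_of_notMem hxΩ]
      rw [indicator_of_notMem (show x ∉ {x : Space n | x (Fin.last n) < 0} from
        fun h => hxΩ (this.2 h))]
  · exact (indicator_apply_eq_zero.2 fun _ => hdiv0 _ hx).trans
      (indicator_apply_eq_zero (f := fun x => divergence V (xbar + x)) |>.2
        fun _ => hdiv0 _ hx).symm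

theorem divergence_smul {f : Space n → ℝ} {V : Space n → Space n} {x : Space n}
    (hf : DifferentiableAt ℝ f x) (hV : DifferentiableAt ℝ V x) :
    divergence (fun y => f y • V y) x = f x * divergence V x + fderiv ℝ f x (V x) := by
  have h1 : fderiv ℝ f x (V x) =
      ∑ i, V x i * fderiv ℝ f x (EuclideanSpace.single i 1) := by
    conv_lhs => rw [← (EuclideanSpace.basisFun (Fin (n + 1)) ℝ).sum_repr (V x)]
    simp
  rw [h1, divergence, divergence, Finset.mul_sum, ← Finset.sum_add_distrib]
  refine Finset.sum_congr rfl fun i _ => ?_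
  rw [fderiv_fun_smul hf hV]
  simp [mul_comm]

theorem divergence_add {V W : Space n → Space n} {x : Space n}
    (hV : DifferentiableAt ℝ V x) (hW : DifferentiableAt ℝ W x) :
    divergence (fun y => V y + W y) x = divergence V x + divergence W x := by
  rw [divergence, fderiv_fun_add hV hW]
  simp [divergence, Finset.sum_add_distrib]

theorem divergence_congr {V W : Space n → Space n} {x : Space n} (h : V =ᶠ[𝓝 x] W) :
    divergence V x = divergence W x := by
  rw [divergence, h.fderiv_eq, divergence]

/-! ### Green's formula for primitives of weak solutions -/

theorem continuous_gradient {ψ : Space n → ℝ} (hψ : ContDiff ℝ ∞ ψ) : Continuous (gradient ψ) :=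
  (InnerProductSpace.toDual ℝ (Space n)).symm.continuous.comp (hψ.continuous_fderiv (by simp))

section Convergence

variable {α : Type*} [MeasurableSpace α] {μ : Measure α} [IsFiniteMeasure μ]

theorem tendsto_eLpNorm_one {F : Type*} [NormedAddCommGroup F] {f : ℕ → α → F}
    (hf : ∀ k, AEStronglyMeasurable (f k) μ)
    (h : Tendsto (fun k => eLpNorm (f k) 2 μ) atTop (𝓝 0)) :
    Tendsto (fun k => eLpNorm (f k) 1 μ) atTop (𝓝 0) := by
  have hc : μ univ ^ (1 / (1 : ℝ≥0∞).toReal - 1 / (2 : ℝ≥0∞).toReal) ≠ ⊤ :=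
    ENNReal.rpow_ne_top_of_nonneg (by norm_num) (measure_ne_top μ _)
  have h' := ENNReal.Tendsto.mul_const h (Or.inr hc)
  rw [zero_mul] at h'
  refine tendsto_of_tendsto_of_tendsto_of_le_of_le tendsto_const_nhds h' (fun _ => zero_le)
    fun k => eLpNorm_le_eLpNorm_mul_rpow_measure_univ (by norm_num) (hf k)

theorem integrable_lipschitz_comp {A : ℝ → ℝ} {C : ℝ≥0} (hA : LipschitzWith C A) {u : α → ℝ}
    (hu : MemLp u 2 μ) : Integrable (fun x => A (u x)) μ := by
  refine Integrable.mono' (((hu.integrable (by norm_num)).norm.const_mul (C : ℝ)).add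
    (integrable_const |A 0|)) (hA.continuous.comp_aestronglyMeasurable hu.1)
    (Eventually.of_forall fun x => ?_)
  have h1 := hA.dist_le_mul (u x) 0
  rw [Real.dist_eq, Real.dist_eq, sub_zero] at h1
  simp only [Pi.add_apply, Real.norm_eq_abs]
  calc |A (u x)| = |(A (u x) - A 0) + A 0| := by ring_nf
    _ ≤ |A (u x) - A 0| + |A 0| := abs_add_le _ _
    _ ≤ _ := by gcongr

theorem integrable_lipschitz_comp_mul {A : ℝ → ℝ} {C : ℝ≥0} (hA : LipschitzWith C A)
    {u : α → ℝ} (hu : MemLp u 2 μ) {w : α → ℝ} {M : ℝ} (hw : AEStronglyMeasurable w μ)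
    (hwM : ∀ x, |w x| ≤ M) : Integrable (fun x => A (u x) * w x) μ :=
  (integrable_lipschitz_comp hA hu).mul_bdd hw (Eventually.of_forall hwM)

theorem tendsto_integral_lipschitz_comp_mul {A : ℝ → ℝ} {C : ℝ≥0} (hA : LipschitzWith C A)
    {ψ : ℕ → α → ℝ} {u : α → ℝ} (hψ : ∀ k, AEStronglyMeasurable (ψ k) μ) (hu : MemLp u 2 μ)
    (h : Tendsto (fun k => eLpNorm (fun x => ψ k x - u x) 2 μ) atTop (𝓝 0))
    {w : α → ℝ} {M : ℝ} (hw : AEStronglyMeasurable w μ) (hwM : ∀ x, |w x| ≤ M) :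
    Tendsto (fun k => ∫ x, A (ψ k x) * w x ∂μ) atTop (𝓝 (∫ x, A (u x) * w x ∂μ)) := by
  refine tendsto_integral_of_L1' _ (integrable_lipschitz_comp_mul hA hu hw hwM).1 ?_ ?_
  · have hev : ∀ᶠ k in atTop, eLpNorm (fun x => ψ k x - u x) 2 μ < ⊤ :=
      h.eventually (gt_mem_nhds ENNReal.zero_lt_top)
    filter_upwards [hev] with k hk
    have hmem : MemLp (ψ k) 2 μ := by
      have h1 : MemLp (fun x => ψ k x - u x) 2 μ := ⟨(hψ k).sub hu.1, hk⟩
      have h2 := h1.add hu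
      have h3 : (fun x => ψ k x - u x) + u = ψ k := by ext; simp
      rwa [h3] at h2
    exact integrable_lipschitz_comp_mul hA hmem hw hwM
  · have h1 := tendsto_eLpNorm_one (fun k => (hψ k).sub hu.1) h
    have h2 : Tendsto (fun k => ENNReal.ofReal (C * M) *
        eLpNorm (fun x => ψ k x - u x) 1 μ) atTop (𝓝 0) := by
      have := ENNReal.Tendsto.const_mul h1
        (Or.inr (ENNReal.ofReal_ne_top (r := C * M)))
      rwa [mul_zero] at this
    refine tendsto_of_tendsto_of_tendsto_of_le_of_le tendsto_const_nhds h2 (fun _ => zero_le)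
      fun k => eLpNorm_le_mul_eLpNorm_of_ae_le_mul (Eventually.of_forall fun x => ?_) 1
    simp only [Pi.sub_apply]
    rw [← sub_mul, norm_mul, ← dist_eq_norm, ← dist_eq_norm]
    calc dist (A (ψ k x)) (A (u x)) * ‖w x‖ ≤ (C * dist (ψ k x) (u x)) * M := by
          gcongr
          · exact hA.dist_le_mul _ _
          · exact hwM x
      _ = _ := by ring

/-- Convergence of the principal part along approximating sequences. Only continuity and boundedness
of `a` are needed, at the price of assuming almost everywhere convergence of `ψ`. -/
theorem tendsto_integral_comp_mul_inner {E : Type*} [NormedAddCommGroup E] [InnerProductSpace ℝ E]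
    {a : ℝ → ℝ} (ha : Continuous a) {C : ℝ} (haC : ∀ s, |a s| ≤ C)
    {ψ : ℕ → α → ℝ} {u : α → ℝ} (hψ : ∀ k, AEStronglyMeasurable (ψ k) μ)
    (hae : ∀ᵐ x ∂μ, Tendsto (fun k => ψ k x) atTop (𝓝 (u x)))
    {Ψ : ℕ → α → E} {U : α → E} (hΨ : ∀ k, AEStronglyMeasurable (Ψ k) μ) (hU : MemLp U 2 μ)
    (h : Tendsto (fun k => eLpNorm (fun x => Ψ k x - U x) 2 μ) atTop (𝓝 0))
    {V : α → E} {M : ℝ} (hV : AEStronglyMeasurable V μ) (hVM : ∀ x, ‖V x‖ ≤ M) :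
    Tendsto (fun k => ∫ x, a (ψ k x) * ⟪Ψ k x, V x⟫_ℝ ∂μ) atTop
      (𝓝 (∫ x, a (u x) * ⟪U x, V x⟫_ℝ ∂μ)) := by
  have hC : 0 ≤ C := (abs_nonneg _).trans (haC 0)
  have hUi : Integrable U μ := hU.integrable (by norm_num)
  have hbound : ∀ (s : ℝ) (p : E) (x : α), ‖a s * ⟪p, V x⟫_ℝ‖ ≤ C * M * ‖p‖ := fun s p x => by
    rw [norm_mul]
    calc ‖a s‖ * ‖⟪p, V x⟫_ℝ‖ ≤ C * (‖p‖ * M) := by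
          gcongr
          · exact haC s
          · exact (norm_inner_le_norm _ _).trans (by gcongr; exact hVM x)
      _ = _ := by ring
  have hm : ∀ (k : ℕ) {W : α → E}, AEStronglyMeasurable W μ →
      AEStronglyMeasurable (fun x => a (ψ k x) * ⟪W x, V x⟫_ℝ) μ := fun k W hW =>
    (ha.comp_aestronglyMeasurable (hψ k)).mul (hW.inner hV)
  have h2 : Tendsto (fun k => ∫ x, a (ψ k x) * ⟪U x, V x⟫_ℝ ∂μ) atTop
      (𝓝 (∫ x, a (u x) * ⟪U x, V x⟫_ℝ ∂μ)) := by
    refine tendsto_integral_of_dominated_convergence (fun x => C * M * ‖U x‖)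
      (fun k => hm k hU.1) (hUi.norm.const_mul _)
      (fun k => Eventually.of_forall fun x => hbound _ _ _) ?_
    filter_upwards [hae] with x hx
    exact ((ha.tendsto _).comp hx).mul_const _
  have h1 : Tendsto (fun k => ∫ x, a (ψ k x) * ⟪Ψ k x - U x, V x⟫_ℝ ∂μ) atTop (𝓝 0) := by
    have hL := tendsto_eLpNorm_one (fun k => (hΨ k).sub hU.1) h
    have hL' : Tendsto (fun k => ENNReal.ofReal (C * M) *
        eLpNorm (fun x => Ψ k x - U x) 1 μ) atTop (𝓝 0) := by
      have := ENNReal.Tendsto.const_mul hL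
        (Or.inr (ENNReal.ofReal_ne_top (r := C * M)))
      rwa [mul_zero] at this
    have hlim : Tendsto (fun k => eLpNorm (fun x => a (ψ k x) * ⟪Ψ k x - U x, V x⟫_ℝ) 1 μ)
        atTop (𝓝 0) :=
      tendsto_of_tendsto_of_tendsto_of_le_of_le tendsto_const_nhds hL' (fun _ => zero_le)
        fun k => eLpNorm_le_mul_eLpNorm_of_ae_le_mul
          (Eventually.of_forall fun x => hbound _ _ _) 1
    have := tendsto_integral_of_L1' (μ := μ) (fun _ => (0 : ℝ)) aestronglyMeasurable_const
      (F := fun k x => a (ψ k x) * ⟪Ψ k x - U x, V x⟫_ℝ) (l := atTop) ?_ (by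
        convert hlim using 3 with k
        ext x; simp)
    · simpa using this
    · filter_upwards [hL.eventually (gt_mem_nhds ENNReal.zero_lt_top)] with k hk
      have hi : Integrable (fun x => Ψ k x - U x) μ :=
        memLp_one_iff_integrable.1 ⟨(hΨ k).sub hU.1, hk⟩
      exact (hi.norm.const_mul (C * M)).mono' (hm k hi.1)
        (Eventually.of_forall fun x => hbound _ _ _)
  have h3 := h1.add h2
  rw [zero_add] at h3
  refine h3.congr' ?_
  have hL := tendsto_eLpNorm_one (fun k => (hΨ k).sub hU.1) h
  filter_upwards [hL.eventually (gt_mem_nhds ENNReal.zero_lt_top)] with k hk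
  have hi : Integrable (fun x => Ψ k x - U x) μ :=
    memLp_one_iff_integrable.1 ⟨(hΨ k).sub hU.1, hk⟩
  rw [← integral_add]
  · refine integral_congr_ae (Eventually.of_forall fun x => ?_)
    simp only
    rw [← mul_add, ← inner_add_left, sub_add_cancel]
  · exact (hi.norm.const_mul (C * M)).mono' (hm k hi.1) (Eventually.of_forall fun x => hbound _ _ _)
  · exact (hUi.norm.const_mul (C * M)).mono' (hm k hU.1)
      (Eventually.of_forall fun x => hbound _ _ _)

end Convergence

theorem lipschitzWith_of_hasDerivAt {a A : ℝ → ℝ} {C : ℝ} (hA : ∀ s, HasDerivAt A (a s) s)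
    (haC : ∀ s, |a s| ≤ C) : LipschitzWith C.toNNReal A := by
  refine lipschitzWith_of_nnnorm_deriv_le (fun s => (hA s).differentiableAt) fun s => ?_
  rw [(hA s).deriv, ← NNReal.coe_le_coe, coe_nnnorm]
  exact (haC s).trans (Real.le_coe_toNNReal C)

/-- Green's formula for `A(ψ)` with `ψ` smooth up to the boundary and `A' = a`, with a general field `V`
in the place of the gradient of the test function. -/
theorem integral_smooth_primitive (hΩ : IsBoundedLipschitzDomain Ω) (hflat : IsFlatPart Ω xbar ε₀)
    {a A : ℝ → ℝ} (ha : Continuous a) (hA : ∀ s, HasDerivAt A (a s) s)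
    {ψ : Space n → ℝ} (hψ : ContDiff ℝ ∞ ψ)
    {V : Space n → Space n} (hV : ContDiff ℝ 1 V) (hVs : tsupport V ⊆ ball xbar ε₀) :
    (∫ x in Ω, A (ψ x) * divergence V x) + ∫ x in Ω, a (ψ x) * ⟪gradient ψ x, V x⟫_ℝ =
      ∫ x, A (ψ x) * ⟪lastUnit n, V x⟫_ℝ ∂(surfaceMeasure Ω) := by
  have hψ1 : ContDiff ℝ 1 ψ := hψ.of_le (by simp)
  have hA1 : ContDiff ℝ 1 A := by
    rw [contDiff_one_iff_deriv]
    refine ⟨fun s => (hA s).differentiableAt, ?_⟩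
    have : deriv A = a := funext fun s => (hA s).deriv
    rwa [this]
  have hAψ : ContDiff ℝ 1 fun x => A (ψ x) := hA1.comp hψ1
  have hVc : HasCompactSupport V :=
    IsCompact.of_isClosed_subset (isCompact_closedBall xbar ε₀) (isClosed_tsupport V)
      (hVs.trans ball_subset_closedBall)
  have hdivc : HasCompactSupport (divergence V) :=
    hVc.mono' fun x hx => by
      by_contra h
      exact hx (divergence_of_notMem_tsupport h)
  have h := integral_divergence hΩ hflat (V := fun x => A (ψ x) • V x) (hAψ.smul hV)
    ((tsupport_smul_subset_right _ _).trans hVs)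
  simp only [inner_smul_right] at h
  rw [← h, ← integral_add]
  · refine integral_congr_ae (Eventually.of_forall fun x => ?_)
    simp only
    rw [divergence_smul (hAψ.differentiable one_ne_zero x) (hV.differentiable one_ne_zero x)]
    have h1 : HasFDerivAt (fun x => A (ψ x)) (a (ψ x) • fderiv ℝ ψ x) x :=
      (hA (ψ x)).comp_hasFDerivAt x (hψ1.differentiable one_ne_zero x).hasFDerivAt
    rw [h1.fderiv, inner_gradient_left]
    simp
  · exact ((hAψ.continuous.mul (continuous_divergence hV)).integrable_of_hasCompactSupport
      hdivc.mul_left).integrableOn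
  · refine (Continuous.integrable_of_hasCompactSupport ?_ ?_).integrableOn
    · exact (ha.comp hψ.continuous).mul ((continuous_gradient hψ).inner hV.continuous)
    · refine hVc.mono' fun x hx => ?_
      by_contra hxV
      exact hx (by simp [image_eq_zero_of_notMem_tsupport hxV])

/-- Green's formula for the transformed solution `A(u)`, `A' = a`. It follows from the case of
functions smooth up to the boundary, since `u` and its trace are limits of such functions. -/
theorem integral_primitive_of_hasTrace (hΩ : IsBoundedLipschitzDomain Ω)
    (hflat : IsFlatPart Ω xbar ε₀) {a A : ℝ → ℝ} (ha : Continuous a) {C : ℝ}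
    (haC : ∀ s, |a s| ≤ C) (hA : ∀ s, HasDerivAt A (a s) s)
    {u : SobolevH1 Ω} {g : Space n → ℝ} (hg : HasTrace u g)
    {V : Space n → Space n} (hV : ContDiff ℝ 1 V) (hVs : tsupport V ⊆ ball xbar ε₀) :
    (∫ x in Ω, A (u.toFun x) * divergence V x) +
      ∫ x in Ω, a (u.toFun x) * ⟪u.grad x, V x⟫_ℝ =
      ∫ x, A (g x) * ⟪lastUnit n, V x⟫_ℝ ∂(surfaceMeasure Ω) := by
  have := isFiniteMeasure_surfaceMeasure hΩ
  have := isFiniteMeasure_restrict hΩ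
  obtain ⟨hgmem, ψ, hψ, ⟨hψu, hψgrad⟩, hψg⟩ := hg
  have hVc : HasCompactSupport V :=
    IsCompact.of_isClosed_subset (isCompact_closedBall xbar ε₀) (isClosed_tsupport V)
      (hVs.trans ball_subset_closedBall)
  have hdivc : HasCompactSupport (divergence V) :=
    hVc.mono' fun x hx => by
      by_contra h
      exact hx (divergence_of_notMem_tsupport h)
  obtain ⟨M, hM⟩ := hV.continuous.bounded_above_of_compact_support hVc
  obtain ⟨M', hM'⟩ := (continuous_divergence hV).bounded_above_of_compact_support hdivc
  have hVe : ∀ x, |⟪lastUnit n, V x⟫_ℝ| ≤ M := fun x => by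
    refine (abs_real_inner_le_norm _ _).trans ?_
    rw [norm_lastUnit, one_mul]
    exact hM x
  have hAL := lipschitzWith_of_hasDerivAt hA haC
  -- Almost everywhere convergence, hence the limit as a whole, is taken along a subsequence.
  obtain ⟨ns, hns, hae⟩ := (tendstoInMeasure_of_tendsto_eLpNorm (p := 2) (by norm_num)
    (fun k => (hψ k).continuous.aestronglyMeasurable) u.memLp_toFun.1 hψu).exists_seq_tendsto_ae
  have hsub := hns.tendsto_atTop
  have t1 := tendsto_integral_lipschitz_comp_mul hAL
    (fun k => (hψ (ns k)).continuous.aestronglyMeasurable) u.memLp_toFun (hψu.comp hsub)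
    (continuous_divergence hV).aestronglyMeasurable hM'
  have t2 := tendsto_integral_comp_mul_inner ha haC
    (fun k => (hψ (ns k)).continuous.aestronglyMeasurable) hae
    (fun k => (continuous_gradient (hψ (ns k))).aestronglyMeasurable) u.memLp_grad
    (hψgrad.comp hsub) hV.continuous.aestronglyMeasurable hM
  have t3 := tendsto_integral_lipschitz_comp_mul hAL
    (fun k => (hψ (ns k)).continuous.aestronglyMeasurable) hgmem (hψg.comp hsub)
    (continuous_const.inner hV.continuous).aestronglyMeasurable hVe
  refine tendsto_nhds_unique ((t1.add t2).congr fun k => ?_) t3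
  exact integral_smooth_primitive hΩ hflat ha hA (hψ (ns k)) hV hVs

/-! ### Test functions and the flux -/

theorem hasCompactSupport_gradient {φ : Space n → ℝ} (hφ : HasCompactSupport φ) :
    HasCompactSupport (gradient φ) :=
  (hφ.fderiv (𝕜 := ℝ)).comp_left (map_zero (InnerProductSpace.toDual ℝ (Space n)).symm)

theorem hasWeakFDeriv_of_contDiff {φ : Space n → ℝ} (hφ : ContDiff ℝ ∞ φ) :
    HasWeakFDeriv Ω φ (fun x => innerSL ℝ (gradient φ x)) := by
  intro η hη hηc hηΩ v
  have h0 : ∀ x ∉ Ω, η x = 0 := fun x hx =>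
    image_eq_zero_of_notMem_tsupport fun h => hx (hηΩ h)
  have h0' : ∀ x ∉ Ω, fderiv ℝ η x v = 0 := fun x hx => by
    have : fderiv ℝ η x = 0 := by
      by_contra h
      exact hx (hηΩ (support_fderiv_subset ℝ h))
    simp [this]
  have hdη : Continuous fun x => fderiv ℝ η x v :=
    (hη.continuous_fderiv (by simp)).clm_apply continuous_const
  have hdφ : Continuous fun x => fderiv ℝ φ x v :=
    (hφ.continuous_fderiv (by simp)).clm_apply continuous_const
  have hdηc : HasCompactSupport fun x => fderiv ℝ η x v := hηc.fderiv_apply (𝕜 := ℝ) v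
  rw [setIntegral_eq_integral_of_forall_compl_eq_zero (fun x hx => by rw [h0' x hx, zero_smul]),
    setIntegral_eq_integral_of_forall_compl_eq_zero (fun x hx => by rw [h0 x hx, zero_smul])]
  simp only [smul_eq_mul, innerSL_apply_apply, inner_gradient_left]
  rw [integral_mul_fderiv_eq_neg_fderiv_mul_of_integrable, neg_neg]
  · exact (hdη.mul hφ.continuous).integrable_of_hasCompactSupport hdηc.mul_right
  · exact (hη.continuous.mul hdφ).integrable_of_hasCompactSupport hηc.mul_right
  · exact (hη.continuous.mul hφ.continuous).integrable_of_hasCompactSupport hηc.mul_right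
  · exact fun x _ => hη.differentiable (by simp) x
  · exact fun x _ => hφ.differentiable (by simp) x

theorem tsupport_gradient_subset (φ : Space n → ℝ) : tsupport (gradient φ) ⊆ tsupport φ := by
  refine closure_minimal (fun x hx => support_fderiv_subset ℝ fun h => hx ?_) (isClosed_tsupport φ)
  rw [gradient, h, map_zero]

/-- A test function on `ℝⁿ⁺¹`, regarded as an element of `H¹(Ω)`. -/
def SobolevH1.ofSmooth (Ω : Set (Space n)) (φ : Space n → ℝ) (hφ : ContDiff ℝ ∞ φ)
    (hφc : HasCompactSupport φ) : SobolevH1 Ω where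
  toFun := φ
  grad := gradient φ
  memLp_toFun := (hφ.continuous.memLp_of_hasCompactSupport hφc).restrict _
  memLp_grad := ((continuous_gradient hφ).memLp_of_hasCompactSupport
    (hasCompactSupport_gradient hφc)).restrict _
  hasWeakGrad := hasWeakFDeriv_of_contDiff hφ

theorem SobolevH1.hasTrace_ofSmooth (hΩ : IsBoundedLipschitzDomain Ω) {φ : Space n → ℝ}
    (hφ : ContDiff ℝ ∞ φ) (hφc : HasCompactSupport φ) :
    HasTrace (SobolevH1.ofSmooth Ω φ hφ hφc) φ := by
  have := isFiniteMeasure_surfaceMeasure hΩ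
  refine ⟨hφ.continuous.memLp_of_hasCompactSupport hφc, fun _ => φ, fun _ => hφ, ⟨?_, ?_⟩, ?_⟩ <;>
    simp [SobolevH1.ofSmooth]

/-- Superposition with a Carathéodory-type coefficient that is continuous on `U ×ˢ univ` preserves
measurability on `U`. -/
theorem aestronglyMeasurable_comp_of_continuousOn {X Z E : Type*} [TopologicalSpace X]
    [MeasurableSpace X] [BorelSpace X] [SecondCountableTopology X]
    [TopologicalSpace Z] [MeasurableSpace Z] [BorelSpace Z] [SecondCountableTopology Z]
    [NormedAddCommGroup E] [MeasurableSpace E] [BorelSpace E] [SecondCountableTopology E]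
    {μ : Measure X} {U : Set X} (hU : MeasurableSet U) {f : X × Z → E}
    (hf : ContinuousOn f (U ×ˢ univ)) {z : X → Z} (hz : AEMeasurable z (μ.restrict U)) :
    AEStronglyMeasurable (fun x => f (x, z x)) (μ.restrict U) := by
  have hF : Measurable ((U ×ˢ (univ : Set Z)).indicator f) := by
    classical
    rw [← piecewise_eq_indicator]
    exact hf.measurable_piecewise continuousOn_const (hU.prod MeasurableSet.univ)
  have h := (hF.comp_aemeasurable (aemeasurable_id.prodMk hz)).aestronglyMeasurable
  refine h.congr ?_
  filter_upwards [ae_restrict_mem hU] with x hx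
  simp [hx]

theorem integrable_bounded_mul_inner {α E : Type*} [MeasurableSpace α] [NormedAddCommGroup E]
    [InnerProductSpace ℝ E] {μ : Measure α} {a : α → ℝ} (ha : AEStronglyMeasurable a μ) {C : ℝ}
    (haC : ∀ x, |a x| ≤ C) {U W : α → E} (hU : MemLp U 2 μ) (hW : MemLp W 2 μ) :
    Integrable (fun x => a x * ⟪U x, W x⟫_ℝ) μ :=
  ((hU.norm.integrable_mul hW.norm).mono' (hU.1.inner hW.1)
    (Eventually.of_forall fun x => norm_inner_le_norm (U x) (W x))).bdd_mul ha
    (Eventually.of_forall haC)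

theorem Coefficients.IsAdmissible.integrable_principal {P : Coefficients n} {C_A : ℝ}
    (hP : P.IsAdmissible Ω C_A) (u φ : SobolevH1 Ω) :
    IntegrableOn (fun x => P.a (u.toFun x) * ⟪u.grad x, φ.grad x⟫_ℝ) Ω :=
  integrable_bounded_mul_inner
    ((continuousOn_univ.1 hP.a_mem.1).comp_aestronglyMeasurable u.memLp_toFun.1)
    (fun _ => hP.a_mem.2.1 _ (mem_univ _)) u.memLp_grad φ.memLp_grad

/-- The lower order part of the flux is bounded by the `W^{1,1}` norm of the test function. -/
theorem Coefficients.IsAdmissible.abs_flux_sub_le {P : Coefficients n} {C_A : ℝ}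
    (hP : P.IsAdmissible Ω C_A) (hΩ : IsBoundedLipschitzDomain Ω) (u φ : SobolevH1 Ω) :
    |P.flux u φ - ∫ x in Ω, P.a (u.toFun x) * ⟪u.grad x, φ.grad x⟫_ℝ| ≤
      C_A * ∫ x in Ω, (‖φ.grad x‖ + |φ.toFun x|) := by
  have := isFiniteMeasure_restrict hΩ
  have hm := hΩ.isOpen.measurableSet
  have hum := u.memLp_toFun.1.aemeasurable
  have hgm := u.memLp_grad.1.aemeasurable
  have hb : AEStronglyMeasurable (fun x => P.b x (u.toFun x)) (volume.restrict Ω) :=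
    aestronglyMeasurable_comp_of_continuousOn hm hP.b_mem.1 hum
  have hc : AEStronglyMeasurable (fun x => P.c x (u.toFun x) (u.grad x)) (volume.restrict Ω) :=
    aestronglyMeasurable_comp_of_continuousOn hm hP.c_mem.1 (hum.prodMk hgm)
  have hi : Integrable (fun x => C_A * (‖φ.grad x‖ + |φ.toFun x|)) (volume.restrict Ω) :=
    ((φ.memLp_grad.integrable (by norm_num)).norm.add
      (φ.memLp_toFun.integrable (by norm_num)).norm).const_mul _
  have hbound : ∀ᵐ x ∂(volume.restrict Ω), ‖⟪P.b x (u.toFun x), φ.grad x⟫_ℝ +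
      P.c x (u.toFun x) (u.grad x) * φ.toFun x‖ ≤ C_A * (‖φ.grad x‖ + |φ.toFun x|) := by
    filter_upwards [ae_restrict_mem hm] with x hx
    have h1 := hP.b_mem.2.1 (x, u.toFun x) ⟨hx, mem_univ _⟩
    have h2 := hP.c_mem.2.1 (x, u.toFun x, u.grad x) ⟨hx, mem_univ _⟩
    simp only at h1 h2
    refine (norm_add_le _ _).trans ?_
    rw [mul_add, norm_mul]
    rw [Real.norm_eq_abs (φ.toFun x)]
    exact add_le_add ((norm_inner_le_norm _ _).trans (by gcongr)) (by gcongr)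
  have hlow : Integrable (fun x => ⟪P.b x (u.toFun x), φ.grad x⟫_ℝ +
      P.c x (u.toFun x) (u.grad x) * φ.toFun x) (volume.restrict Ω) :=
    hi.mono' ((hb.inner φ.memLp_grad.1).add (hc.mul φ.memLp_toFun.1)) hbound
  have hsplit : P.flux u φ = (∫ x in Ω, P.a (u.toFun x) * ⟪u.grad x, φ.grad x⟫_ℝ) +
      ∫ x in Ω, (⟪P.b x (u.toFun x), φ.grad x⟫_ℝ +
        P.c x (u.toFun x) (u.grad x) * φ.toFun x) := by
    rw [← integral_add (hP.integrable_principal u φ) hlow, Coefficients.flux]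
    refine integral_congr_ae (Eventually.of_forall fun x => ?_)
    simp only [inner_add_left, real_inner_smul_left]
    ring
  rw [hsplit, add_sub_cancel_left, ← integral_const_mul]
  exact norm_integral_le_of_norm_le hi hbound

theorem SobolevH1.integral_abs_le (hΩ : IsBoundedLipschitzDomain Ω) {u : SobolevH1 Ω} {C : ℝ}
    (hu : u.norm ≤ C) : ∫ x in Ω, |u.toFun x| ≤ volume.real Ω + C ^ 2 := by
  have := isFiniteMeasure_restrict hΩ
  have h1 : Integrable (fun x => u.toFun x ^ 2 + ‖u.grad x‖ ^ 2) (volume.restrict Ω) :=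
    u.memLp_toFun.integrable_sq.add u.memLp_grad.norm.integrable_sq
  have h2 : ∫ x in Ω, (u.toFun x ^ 2 + ‖u.grad x‖ ^ 2) ≤ C ^ 2 := by
    rw [← Real.sq_sqrt (integral_nonneg fun x => by positivity)]
    exact pow_le_pow_left₀ (Real.sqrt_nonneg _) hu 2
  calc ∫ x in Ω, |u.toFun x| ≤ ∫ x in Ω, (1 + (u.toFun x ^ 2 + ‖u.grad x‖ ^ 2)) := by
        refine integral_mono (u.memLp_toFun.integrable (by norm_num)).norm
          ((integrable_const 1).add h1) fun x => ?_
        simp only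
        have := sq_abs (u.toFun x)
        nlinarith [sq_nonneg (|u.toFun x| - 1), sq_nonneg ‖u.grad x‖, abs_nonneg (u.toFun x)]
    _ = volume.real Ω + ∫ x in Ω, (u.toFun x ^ 2 + ‖u.grad x‖ ^ 2) := by
        rw [integral_add (integrable_const 1) h1]
        simp
    _ ≤ _ := by gcongr

/-! ### The harmonic dipole -/

/-- The power `|y|^{2t}`. -/
def normSqPow (n : ℕ) (t : ℝ) (y : Space n) : ℝ := (‖y‖ ^ 2) ^ t

theorem normSqPow_eq (t : ℝ) (y : Space n) : normSqPow n t y = ‖y‖ ^ (2 * t) := by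
  rw [normSqPow, ← Real.rpow_natCast, ← Real.rpow_mul (norm_nonneg y)]
  norm_num

theorem normSqPow_nonneg (t : ℝ) (y : Space n) : 0 ≤ normSqPow n t y := by
  unfold normSqPow; positivity

theorem normSqPow_mul_sq {y : Space n} (hy : y ≠ 0) (t : ℝ) :
    normSqPow n (t - 1) y * ‖y‖ ^ 2 = normSqPow n t y := by
  have : 0 < ‖y‖ ^ 2 := by positivity
  rw [normSqPow, normSqPow, Real.rpow_sub_one this.ne', div_mul_cancel₀ _ this.ne']

theorem hasFDerivAt_normSqPow {y : Space n} (hy : y ≠ 0) (t : ℝ) :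
    HasFDerivAt (normSqPow n t) ((2 * t * normSqPow n (t - 1) y) • innerSL ℝ y) y := by
  have h0 : ‖y‖ ^ 2 ≠ 0 := by positivity
  have h := (Real.hasDerivAt_rpow_const (p := t) (Or.inl h0)).comp_hasFDerivAt y
    (hasStrictFDerivAt_norm_sq y).hasFDerivAt
  refine h.congr_fderiv ?_
  ext v
  simp [normSqPow]
  ring

theorem contDiffAt_normSqPow {y : Space n} (hy : y ≠ 0) (t : ℝ) :
    ContDiffAt ℝ ∞ (normSqPow n t) y := by
  have h0 : ‖y‖ ^ 2 ≠ 0 := by positivity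
  exact (contDiff_norm_sq ℝ).contDiffAt.rpow_const_of_ne h0

/-- The dipole `y_d |y|^{-d}`, `d = n + 1`: a multiple of the `d`-th partial derivative of the
fundamental solution of the Laplace equation. -/
def dipole (n : ℕ) (y : Space n) : ℝ :=
  normSqPow n (-((n : ℝ) + 1) / 2) y * ⟪lastUnit n, y⟫_ℝ

/-- The gradient of the dipole away from its pole. -/
def dipoleGrad (n : ℕ) (y : Space n) : Space n :=
  normSqPow n (-((n : ℝ) + 1) / 2) y • lastUnit n +
    (-((n : ℝ) + 1) * (⟪lastUnit n, y⟫_ℝ * normSqPow n (-((n : ℝ) + 1) / 2 - 1) y)) • y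

theorem contDiffAt_dipole {y : Space n} (hy : y ≠ 0) : ContDiffAt ℝ ∞ (dipole n) y :=
  (contDiffAt_normSqPow hy _).mul (contDiff_const.inner ℝ contDiff_id).contDiffAt

theorem hasFDerivAt_inner_lastUnit (y : Space n) :
    HasFDerivAt (fun y => ⟪lastUnit n, y⟫_ℝ) (innerSL ℝ (lastUnit n)) y :=
  (innerSL ℝ (lastUnit n)).hasFDerivAt

theorem hasFDerivAt_dipole {y : Space n} (hy : y ≠ 0) :
    HasFDerivAt (dipole n) (innerSL ℝ (dipoleGrad n y)) y := by
  refine ((hasFDerivAt_normSqPow hy _).mul (hasFDerivAt_inner_lastUnit y)).congr_fderiv ?_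
  ext v
  simp [dipoleGrad]
  ring

theorem divergence_id (y : Space n) : divergence (fun y => y) y = n + 1 := by
  simp [divergence]

theorem divergence_const (v y : Space n) : divergence (fun _ => v) y = 0 := by
  simp [divergence]

theorem hasFDerivAt_dipoleGrad_coeff {y : Space n} (hy : y ≠ 0) :
    HasFDerivAt (fun y => -((n : ℝ) + 1) *
        (⟪lastUnit n, y⟫_ℝ * normSqPow n (-((n : ℝ) + 1) / 2 - 1) y))
      (-((n : ℝ) + 1) • (⟪lastUnit n, y⟫_ℝ • (2 * (-((n : ℝ) + 1) / 2 - 1) *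
        normSqPow n (-((n : ℝ) + 1) / 2 - 1 - 1) y) • innerSL ℝ y +
        normSqPow n (-((n : ℝ) + 1) / 2 - 1) y • innerSL ℝ (lastUnit n))) y :=
  ((hasFDerivAt_inner_lastUnit y).mul (hasFDerivAt_normSqPow hy _)).const_mul _

theorem differentiableAt_dipoleGrad {y : Space n} (hy : y ≠ 0) :
    DifferentiableAt ℝ (dipoleGrad n) y :=
  ((hasFDerivAt_normSqPow hy _).differentiableAt.smul_const _).add
    ((hasFDerivAt_dipoleGrad_coeff hy).differentiableAt.smul differentiableAt_fun_id)

/-- The dipole is harmonic away from its pole. -/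
theorem divergence_dipoleGrad {y : Space n} (hy : y ≠ 0) : divergence (dipoleGrad n) y = 0 := by
  have h1 := hasFDerivAt_normSqPow hy (-((n : ℝ) + 1) / 2)
  have h2 := hasFDerivAt_dipoleGrad_coeff hy
  have hadd := divergence_add (h1.differentiableAt.smul_const (lastUnit n))
    (h2.differentiableAt.smul differentiableAt_fun_id)
  refine hadd.trans ?_
  have e1 := divergence_smul h1.differentiableAt (differentiableAt_const (lastUnit n))
  have e2 := divergence_smul h2.differentiableAt differentiableAt_fun_id
  rw [divergence_const, h1.fderiv] at e1
  rw [divergence_id, h2.fderiv] at e2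
  refine (congrArg₂ (· + ·) e1 e2).trans ?_
  simp only [smul_apply, add_apply, innerSL_apply_apply,
    smul_eq_mul, real_inner_self_eq_norm_sq, real_inner_comm (lastUnit n) y]
  have h3 := normSqPow_mul_sq hy (-((n : ℝ) + 1) / 2 - 1)
  linear_combination (-((n : ℝ) + 1) * ⟪lastUnit n, y⟫_ℝ *
    (2 * (-((n : ℝ) + 1) / 2 - 1))) * h3

theorem abs_inner_lastUnit_le (y : Space n) : |⟪lastUnit n, y⟫_ℝ| ≤ ‖y‖ := by
  simpa [norm_lastUnit] using abs_real_inner_le_norm (lastUnit n) y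

theorem abs_dipole_le (y : Space n) : |dipole n y| ≤ ‖y‖ ^ (-((n : ℝ) + 1)) * ‖y‖ := by
  rw [dipole, abs_mul, abs_of_nonneg (normSqPow_nonneg _ _), normSqPow_eq]
  have : 2 * (-((n : ℝ) + 1) / 2) = -((n : ℝ) + 1) := by ring
  rw [this]
  gcongr
  exact abs_inner_lastUnit_le y

theorem norm_dipoleGrad_le {y : Space n} (hy : y ≠ 0) :
    ‖dipoleGrad n y‖ ≤ (n + 2) * ‖y‖ ^ (-((n : ℝ) + 1)) := by
  have h := normSqPow_mul_sq hy (-((n : ℝ) + 1) / 2)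
  have h1 : normSqPow n (-((n : ℝ) + 1) / 2) y = ‖y‖ ^ (-((n : ℝ) + 1)) := by
    rw [normSqPow_eq]; congr 1; ring
  rw [← h1, dipoleGrad]
  have hp := normSqPow_nonneg (-((n : ℝ) + 1) / 2 - 1) y
  calc _ ≤ normSqPow n (-((n : ℝ) + 1) / 2) y +
        ((n : ℝ) + 1) * (‖y‖ * normSqPow n (-((n : ℝ) + 1) / 2 - 1) y) * ‖y‖ := by
        refine (norm_add_le _ _).trans ?_
        rw [norm_smul, norm_smul, norm_lastUnit, mul_one, Real.norm_eq_abs, Real.norm_eq_abs,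
          abs_of_nonneg (normSqPow_nonneg _ _), abs_mul, abs_neg, abs_mul, abs_of_nonneg hp,
          abs_of_nonneg (by positivity : (0 : ℝ) ≤ (n : ℝ) + 1)]
        gcongr
        exact abs_inner_lastUnit_le y
    _ = _ := by linear_combination ((n : ℝ) + 1) * h

theorem inner_dipoleGrad {y : Space n} (hy : y ≠ 0) :
    ⟪lastUnit n, dipoleGrad n y⟫_ℝ = normSqPow n (-((n : ℝ) + 1) / 2 - 1) y *
      (‖y‖ ^ 2 - (n + 1) * ⟪lastUnit n, y⟫_ℝ ^ 2) := by
  rw [dipoleGrad, inner_add_right, inner_smul_right, inner_smul_right, real_inner_self_eq_norm_sq,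
    norm_lastUnit, ← normSqPow_mul_sq hy]
  ring

theorem integrableOn_norm_rpow_ball (R : ℝ) :
    IntegrableOn (fun x : Space n => ‖x‖ ^ (-((n : ℝ) + 1 - 1 / 4))) (ball 0 R) := by
  refine integrableOn_ball_of_norm_le_rpow (C := 1) (α := (n : ℝ) + 1 - 1 / 4) (by simp)
    (by simp) (Eventually.of_forall fun x => ?_) ?_
  · rw [one_mul, Real.norm_of_nonneg (by positivity)]
  · exact (measurable_norm.pow_const _).aestronglyMeasurable

/-! ### Test functions concentrated at the boundary point -/

theorem contDiff_gradient {ψ : Space n → ℝ} (hψ : ContDiff ℝ ∞ ψ) : ContDiff ℝ 1 (gradient ψ) :=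
  (InnerProductSpace.toDual ℝ (Space n)).symm.contDiff.comp
    (hψ.fderiv_right (m := 1) (by norm_cast))

theorem gradient_eq_of_hasFDerivAt {f : Space n → ℝ} {x v : Space n}
    (h : HasFDerivAt f (innerSL ℝ v) x) : gradient f x = v :=
  ext_inner_right ℝ fun w => by rw [inner_gradient_left, h.fderiv, innerSL_apply_apply]

/-- The dipole with pole `x̄ + δ e_d`, cut off by `χ`, and by a function of the last coordinate which
removes the pole and leaves the part below `x̄ + (δ/3) e_d` unchanged. -/
def cutoffDipole (χ : Space n → ℝ) (xbar : Space n) (δ : ℝ) (x : Space n) : ℝ :=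
  χ x * (Real.smoothTransition (2 - 3 * (⟪lastUnit n, x - xbar⟫_ℝ / δ)) *
    dipole n (x - (xbar + δ • lastUnit n)))

theorem inner_sub_pole (x xbar : Space n) (δ : ℝ) :
    ⟪lastUnit n, x - (xbar + δ • lastUnit n)⟫_ℝ = ⟪lastUnit n, x - xbar⟫_ℝ - δ := by
  rw [← sub_sub, inner_sub_right, inner_smul_right, real_inner_self_eq_norm_sq, norm_lastUnit]
  ring

theorem sub_pole_ne_zero {x xbar : Space n} {δ : ℝ} (h : ⟪lastUnit n, x - xbar⟫_ℝ < δ) :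
    x - (xbar + δ • lastUnit n) ≠ 0 := fun h0 => by
  have := inner_sub_pole x xbar δ
  rw [h0, inner_zero_right] at this
  linarith

theorem le_norm_sub_pole {x xbar : Space n} {δ : ℝ} (h : ⟪lastUnit n, x - xbar⟫_ℝ ≤ 0) :
    δ ≤ ‖x - (xbar + δ • lastUnit n)‖ := by
  have h1 := abs_inner_lastUnit_le (x - (xbar + δ • lastUnit n))
  rw [inner_sub_pole] at h1
  have := neg_abs_le (⟪lastUnit n, x - xbar⟫_ℝ - δ)
  linarith

theorem contDiff_cutoffDipole {χ : Space n → ℝ} (hχ : ContDiff ℝ ∞ χ) {δ : ℝ} (hδ : 0 < δ) :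
    ContDiff ℝ ∞ (cutoffDipole χ xbar δ) := by
  refine contDiff_iff_contDiffAt.2 fun x => hχ.contDiffAt.mul ?_
  have hin : Continuous fun x : Space n => ⟪lastUnit n, x - xbar⟫_ℝ := by fun_prop
  rcases lt_or_ge (⟪lastUnit n, x - xbar⟫_ℝ) δ with h | h
  · refine ContDiffAt.mul ?_ ?_
    · refine Real.smoothTransition.contDiff.contDiffAt.comp x (ContDiff.contDiffAt ?_)
      exact contDiff_const.sub (contDiff_const.mul
        ((contDiff_const.inner ℝ (contDiff_id.sub contDiff_const)).div_const _))
    · exact (contDiffAt_dipole (sub_pole_ne_zero h)).comp x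
        (contDiff_id.sub contDiff_const).contDiffAt
  · refine (contDiffAt_const (c := (0 : ℝ))).congr_of_eventuallyEq ?_
    have hopen : IsOpen {x : Space n | 2 / 3 * δ < ⟪lastUnit n, x - xbar⟫_ℝ} :=
      isOpen_lt continuous_const hin
    filter_upwards [hopen.mem_nhds (show 2 / 3 * δ < ⟪lastUnit n, x - xbar⟫_ℝ by linarith)]
      with y hy
    have hy' : 2 / 3 * δ < ⟪lastUnit n, y - xbar⟫_ℝ := hy
    rw [Real.smoothTransition.zero_of_nonpos, zero_mul]
    have := (lt_div_iff₀ hδ).2 hy'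
    linarith

theorem cutoffDipole_eventuallyEq (χ : Space n → ℝ) {δ : ℝ} (hδ : 0 < δ) {x : Space n}
    (hx : ⟪lastUnit n, x - xbar⟫_ℝ ≤ 0) :
    ∀ᶠ y in 𝓝 x, cutoffDipole χ xbar δ y = χ y * dipole n (y - (xbar + δ • lastUnit n)) ∧
      y - (xbar + δ • lastUnit n) ≠ 0 := by
  have hin : Continuous fun x : Space n => ⟪lastUnit n, x - xbar⟫_ℝ := by fun_prop
  have hopen : IsOpen {x : Space n | ⟪lastUnit n, x - xbar⟫_ℝ < 1 / 3 * δ} :=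
    isOpen_lt hin continuous_const
  filter_upwards [hopen.mem_nhds (show ⟪lastUnit n, x - xbar⟫_ℝ < 1 / 3 * δ from
    hx.trans_lt (by positivity))] with y hy
  have hy' : ⟪lastUnit n, y - xbar⟫_ℝ < 1 / 3 * δ := hy
  refine ⟨?_, sub_pole_ne_zero (by linarith)⟩
  rw [cutoffDipole, Real.smoothTransition.one_of_one_le, one_mul]
  have := (div_lt_iff₀ hδ).2 hy'
  linarith

theorem gradient_mul_dipole {χ : Space n → ℝ} (hχ : ContDiff ℝ ∞ χ) {p x : Space n}
    (hx : x - p ≠ 0) :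
    gradient (fun y => χ y * dipole n (y - p)) x =
      χ x • dipoleGrad n (x - p) + dipole n (x - p) • gradient χ x := by
  have h1 : HasFDerivAt χ (fderiv ℝ χ x) x := (hχ.differentiable (by simp) x).hasFDerivAt
  have h2 : HasFDerivAt (fun y => dipole n (y - p)) (innerSL ℝ (dipoleGrad n (x - p))) x :=
    (hasFDerivAt_comp_sub p).2 (hasFDerivAt_dipole hx)
  refine gradient_eq_of_hasFDerivAt ((h1.mul h2).congr_fderiv ?_)
  ext v
  simp

/-- Below the hyperplane through `x̄` the cut-off near the pole has no effect on the gradient. -/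
theorem eventually_gradient_cutoffDipole {χ : Space n → ℝ} (hχ : ContDiff ℝ ∞ χ) {δ : ℝ}
    (hδ : 0 < δ) {x : Space n} (hx : ⟪lastUnit n, x - xbar⟫_ℝ ≤ 0) :
    gradient (cutoffDipole χ xbar δ) =ᶠ[𝓝 x] fun y =>
      χ y • dipoleGrad n (y - (xbar + δ • lastUnit n)) +
        dipole n (y - (xbar + δ • lastUnit n)) • gradient χ y := by
  filter_upwards [(cutoffDipole_eventuallyEq χ hδ hx).eventually_nhds] with y hy
  have hyz : _ =ᶠ[𝓝 y] _ := hy.mono fun z hz => hz.1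
  rw [hyz.gradient_eq, gradient_mul_dipole hχ hy.self_of_nhds.2]

theorem divergence_comp_sub (V : Space n → Space n) (p x : Space n) :
    divergence (fun y => V (y - p)) x = divergence V (x - p) := by
  simp only [divergence, fderiv_comp_sub]

/-- By harmonicity of the dipole, its Laplacian after multiplication with a cut-off function only
involves derivatives of the cut-off function. -/
theorem divergence_gradient_cutoffDipole {χ : Space n → ℝ} (hχ : ContDiff ℝ ∞ χ) {δ : ℝ}
    (hδ : 0 < δ) {x : Space n} (hx : ⟪lastUnit n, x - xbar⟫_ℝ ≤ 0) :
    divergence (gradient (cutoffDipole χ xbar δ)) x =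
      2 * ⟪gradient χ x, dipoleGrad n (x - (xbar + δ • lastUnit n))⟫_ℝ +
        dipole n (x - (xbar + δ • lastUnit n)) * divergence (gradient χ) x := by
  rw [divergence_congr (eventually_gradient_cutoffDipole hχ hδ hx)]
  set p := xbar + δ • lastUnit n with hp
  have hne : x - p ≠ 0 := sub_pole_ne_zero (hx.trans_lt hδ)
  have h1 : DifferentiableAt ℝ χ x := hχ.differentiable (by simp) x
  have h2 : HasFDerivAt (fun y => dipole n (y - p)) (innerSL ℝ (dipoleGrad n (x - p))) x :=
    (hasFDerivAt_comp_sub p).2 (hasFDerivAt_dipole hne)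
  have h3 : DifferentiableAt ℝ (fun y => dipoleGrad n (y - p)) x :=
    (differentiableAt_comp_sub p).2 (differentiableAt_dipoleGrad hne)
  have h4 : DifferentiableAt ℝ (gradient χ) x :=
    (contDiff_gradient hχ).differentiable one_ne_zero x
  rw [divergence_add (h1.fun_smul h3) (h2.differentiableAt.fun_smul h4), divergence_smul h1 h3,
    divergence_smul h2.differentiableAt h4, divergence_comp_sub, divergence_dipoleGrad hne,
    h2.fderiv, innerSL_apply_apply, ← inner_gradient_left, real_inner_comm (gradient χ x)]
  ring

/-- The singular test functions: their Laplacian is bounded on `Ω` uniformly in `δ`, their `W^{1,1}` norm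
is `O(δ^{-1/4})`, and their normal derivative is at most `-c δ^{-d}` on the boundary near `x̄`. -/
theorem exists_testFunction (hn : 1 ≤ n) (hΩ : IsBoundedLipschitzDomain Ω)
    (hflat : IsFlatPart Ω xbar ε₀) :
    ∃ K c : ℝ, 0 < c ∧ ∀ δ : ℝ, 0 < δ → δ ≤ ε₀ / 8 → ∃ φ : Space n → ℝ, ContDiff ℝ ∞ φ ∧
      tsupport φ ⊆ ball xbar ε₀ ∧ (∀ x ∈ Ω, |divergence (gradient φ) x| ≤ K) ∧
      (∫ x in Ω, (‖gradient φ x‖ + |φ x|) ≤ K * δ ^ (-(1 / 4) : ℝ)) ∧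
      ∀ x ∈ ball xbar (δ / 2), ⟪lastUnit n, x - xbar⟫_ℝ = 0 →
        ⟪lastUnit n, gradient φ x⟫_ℝ ≤ -(c / δ ^ (n + 1)) := by
  have hε := hflat.pos
  -- The cut-off is `1` on `B_{ε₀/2}(x̄)`; where its derivatives live, the pole is at distance `≥ ε₀/4`,
  -- which bounds the Laplacian by `K₁`.
  obtain ⟨χ, hχin, hχout⟩ : ∃ χ : ContDiffBump xbar, χ.rIn = ε₀ / 2 ∧ χ.rOut = 3 * ε₀ / 4 :=
    ⟨⟨ε₀ / 2, 3 * ε₀ / 4, by positivity, by linarith⟩, rfl, rfl⟩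
  have hχ : ContDiff ℝ ∞ χ := χ.contDiff
  have hχc : HasCompactSupport χ := χ.hasCompactSupport
  have hdivc : HasCompactSupport (divergence (gradient χ)) :=
    (hasCompactSupport_gradient hχc).mono' fun x hx => by
      by_contra h
      exact hx (divergence_of_notMem_tsupport h)
  obtain ⟨M₁, hM₁⟩ := (continuous_gradient hχ).bounded_above_of_compact_support
    (hasCompactSupport_gradient hχc)
  obtain ⟨M₂, hM₂⟩ := (continuous_divergence (contDiff_gradient hχ)).bounded_above_of_compact_support
    hdivc
  have hM₁0 : 0 ≤ M₁ := (norm_nonneg _).trans (hM₁ 0)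
  have hM₂0 : 0 ≤ M₂ := (norm_nonneg _).trans (hM₂ 0)
  set I : ℝ := ∫ x in ball (0 : Space n) (2 * ε₀), ‖x‖ ^ (-((n : ℝ) + 1 - 1 / 4)) with hI
  have hI0 : 0 ≤ I := integral_nonneg fun x => by positivity
  set s₀ : ℝ := (ε₀ / 4) ^ (-((n : ℝ) + 1)) with hs₀
  have hs₀0 : 0 ≤ s₀ := by positivity
  set K₁ : ℝ := 2 * (M₁ * ((n + 2) * s₀)) + s₀ * (2 * ε₀) * M₂ with hK₁
  have hK₁0 : 0 ≤ K₁ := by positivity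
  set K₂ : ℝ := (n + 2) + 2 * ε₀ * M₁ + 2 * ε₀ with hK₂
  have hK₂0 : 0 ≤ K₂ := by positivity
  have hχone : ∀ x, dist x xbar < ε₀ / 2 →
      gradient χ x = 0 ∧ gradient χ =ᶠ[𝓝 x] fun _ => 0 := fun x hx => by
    have h1 : ∀ᶠ y in 𝓝 x, (χ : Space n → ℝ) =ᶠ[𝓝 y] fun _ => 1 :=
      (χ.eventuallyEq_one_of_mem_ball (by rwa [mem_ball, hχin])).eventually_nhds
    have h2 : gradient χ =ᶠ[𝓝 x] fun _ => 0 := h1.mono fun y hy => by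
      rw [hy.gradient_eq, gradient_fun_const]
    exact ⟨h2.self_of_nhds, h2⟩
  refine ⟨max K₁ (K₂ * I), 3 / 4 * (5 / 4 : ℝ) ^ (-((n : ℝ) + 1) / 2 - 1), by positivity,
    fun δ hδ hδε => ?_⟩
  have hsupp : tsupport (cutoffDipole χ xbar δ) ⊆ ball xbar ε₀ := by
    refine (tsupport_mul_subset_left (f := χ)).trans ?_
    rw [χ.tsupport_eq, hχout]
    exact closedBall_subset_ball (by linarith)
  have hupper : ∀ x ∈ ball xbar ε₀, ‖x - (xbar + δ • lastUnit n)‖ < 2 * ε₀ := fun x hx => by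
    rw [mem_ball, dist_eq_norm] at hx
    have := norm_sub_le (x - xbar) (δ • lastUnit n)
    rw [norm_smul, norm_lastUnit, mul_one, Real.norm_of_nonneg hδ.le] at this
    rw [← sub_sub]
    linarith
  refine ⟨cutoffDipole χ xbar δ, contDiff_cutoffDipole hχ hδ, hsupp, ?_, ?_, ?_⟩
  · intro x hx
    by_cases hxb : x ∈ ball xbar ε₀
    swap
    · rw [divergence_of_notMem_tsupport fun h => hxb (hsupp (tsupport_gradient_subset _ h)),
        abs_zero]
      exact hK₁0.trans (le_max_left _ _)
    refine le_trans ?_ (le_max_left _ _)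
    have hin : ⟪lastUnit n, x - xbar⟫_ℝ ≤ 0 := ((hflat.flat x hxb).1 hx).le
    rw [divergence_gradient_cutoffDipole hχ hδ hin]
    rcases lt_or_ge (dist x xbar) (ε₀ / 2) with h | h
    · obtain ⟨h1, h2⟩ := hχone x h
      rw [h1, divergence_congr h2, divergence_const]
      simpa using hK₁0
    · set y := x - (xbar + δ • lastUnit n) with hy
      have hne : y ≠ 0 := sub_pole_ne_zero (hin.trans_lt hδ)
      have hlow : ε₀ / 4 ≤ ‖y‖ := by
        have h3 : ‖x - xbar‖ ≤ ‖y‖ + δ := by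
          have := norm_add_le y (δ • lastUnit n)
          rwa [norm_smul, norm_lastUnit, mul_one, Real.norm_of_nonneg hδ.le,
            show y + δ • lastUnit n = x - xbar by rw [hy]; abel] at this
        rw [dist_eq_norm] at h
        linarith
      have hs : ‖y‖ ^ (-((n : ℝ) + 1)) ≤ s₀ :=
        Real.rpow_le_rpow_of_nonpos (by positivity) hlow (by linarith [n.cast_nonneg (α := ℝ)])
      have hup := hupper x hxb
      refine (abs_add_le _ _).trans (add_le_add ?_ ?_)
      · rw [abs_mul, abs_two]
        gcongr
        refine (abs_real_inner_le_norm _ _).trans ?_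
        gcongr
        · exact hM₁ x
        · exact (norm_dipoleGrad_le hne).trans (by gcongr)
      · rw [abs_mul]
        gcongr
        · exact (abs_dipole_le y).trans (by gcongr)
        · exact hM₂ x
  · set p := xbar + δ • lastUnit n with hp
    set G : Space n → ℝ := (ball p (2 * ε₀)).indicator
      fun x => ‖x - p‖ ^ (-((n : ℝ) + 1 - 1 / 4)) with hG
    have hGeq : G = fun x => (ball (0 : Space n) (2 * ε₀)).indicator
        (fun x => ‖x‖ ^ (-((n : ℝ) + 1 - 1 / 4))) (x - p) := by
      ext x
      have hiff : x ∈ ball p (2 * ε₀) ↔ x - p ∈ ball (0 : Space n) (2 * ε₀) := by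
        rw [mem_ball_zero_iff, mem_ball, dist_eq_norm]
      by_cases hx : x ∈ ball p (2 * ε₀)
      · rw [hG, indicator_of_mem hx, indicator_of_mem (hiff.1 hx)]
      · rw [hG, indicator_of_notMem hx, indicator_of_notMem fun h => hx (hiff.2 h)]
    have hGi : Integrable G := by
      rw [hGeq]
      exact ((integrable_indicator_iff measurableSet_ball).2
        (integrableOn_norm_rpow_ball (2 * ε₀))).comp_sub_right p
    have hGI : ∫ x, G x = I := by
      rw [hGeq, integral_sub_right_eq_self
        (fun x => (ball (0 : Space n) (2 * ε₀)).indicator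
          (fun x => ‖x‖ ^ (-((n : ℝ) + 1 - 1 / 4))) x) p,
        integral_indicator measurableSet_ball]
    have hG0 : ∀ x, 0 ≤ G x := fun x => indicator_nonneg (fun _ _ => by positivity) x
    have hδ4 : 0 ≤ δ ^ (-(1 / 4) : ℝ) := by positivity
    have hpt : ∀ x ∈ Ω, ‖gradient (cutoffDipole χ xbar δ) x‖ + |cutoffDipole χ xbar δ x| ≤
        K₂ * δ ^ (-(1 / 4) : ℝ) * G x := by
      intro x hx
      by_cases hxb : x ∈ ball xbar ε₀
      swap
      · have h1 : cutoffDipole χ xbar δ x = 0 :=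
          image_eq_zero_of_notMem_tsupport fun h => hxb (hsupp h)
        have h2 : gradient (cutoffDipole χ xbar δ) x = 0 :=
          image_eq_zero_of_notMem_tsupport fun h => hxb (hsupp (tsupport_gradient_subset _ h))
        rw [h1, h2, norm_zero, abs_zero, add_zero]
        exact mul_nonneg (by positivity) (hG0 x)
      have hin : ⟪lastUnit n, x - xbar⟫_ℝ ≤ 0 := ((hflat.flat x hxb).1 hx).le
      have hlow := le_norm_sub_pole (δ := δ) hin
      have hne : x - p ≠ 0 := sub_pole_ne_zero (hin.trans_lt hδ)
      have hup := hupper x hxb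
      rw [(cutoffDipole_eventuallyEq χ hδ hin).self_of_nhds.1,
        (eventually_gradient_cutoffDipole hχ hδ hin).self_of_nhds, hG,
        indicator_of_mem (by rw [mem_ball, dist_eq_norm]; exact hup)]
      set r := ‖x - p‖ with hr
      have hr0 : 0 < r := norm_pos_iff.2 hne
      have hχ1 : |χ x| ≤ 1 := by rw [abs_of_nonneg χ.nonneg]; exact χ.le_one
      have hdip : |dipole n (x - p)| ≤ r ^ (-((n : ℝ) + 1)) * (2 * ε₀) :=
        (abs_dipole_le _).trans (by gcongr)
      -- Since `r ≥ δ`, a factor `r^{-1/4}` can be traded for `δ^{-1/4}`, leaving an integrable power of `r`.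
      have hpow : r ^ (-((n : ℝ) + 1)) ≤ δ ^ (-(1 / 4) : ℝ) * r ^ (-((n : ℝ) + 1 - 1 / 4)) := by
        have : r ^ (-((n : ℝ) + 1)) = r ^ (-(1 / 4) : ℝ) * r ^ (-((n : ℝ) + 1 - 1 / 4)) := by
          rw [← Real.rpow_add hr0]; congr 1; ring
        rw [this]
        exact mul_le_mul_of_nonneg_right
          (Real.rpow_le_rpow_of_nonpos hδ hlow (by norm_num)) (by positivity)
      calc _ ≤ (1 * ((n + 2) * r ^ (-((n : ℝ) + 1))) + r ^ (-((n : ℝ) + 1)) * (2 * ε₀) * M₁) +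
            1 * (r ^ (-((n : ℝ) + 1)) * (2 * ε₀)) := by
            refine add_le_add ((norm_add_le _ _).trans ?_) ?_
            · rw [norm_smul, norm_smul]
              gcongr
              · exact hχ1
              · exact norm_dipoleGrad_le hne
              · exact hdip
              · exact hM₁ x
            · rw [abs_mul]
              gcongr
        _ = K₂ * r ^ (-((n : ℝ) + 1)) := by rw [hK₂]; ring
        _ ≤ K₂ * (δ ^ (-(1 / 4) : ℝ) * r ^ (-((n : ℝ) + 1 - 1 / 4))) := by gcongr
        _ = _ := by ring
    calc _ ≤ ∫ x in Ω, K₂ * δ ^ (-(1 / 4) : ℝ) * G x := by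
          refine integral_mono_of_nonneg (Eventually.of_forall fun x => by positivity)
            (hGi.const_mul _).integrableOn ?_
          filter_upwards [ae_restrict_mem hΩ.isOpen.measurableSet] with x hx using hpt x hx
      _ ≤ ∫ x, K₂ * δ ^ (-(1 / 4) : ℝ) * G x :=
          setIntegral_le_integral (hGi.const_mul _) (Eventually.of_forall fun x =>
            mul_nonneg (by positivity) (hG0 x))
      _ = K₂ * I * δ ^ (-(1 / 4) : ℝ) := by rw [integral_const_mul, hGI]; ring
      _ ≤ _ := by gcongr; exact le_max_right _ _
  · intro x hx hin
    rw [mem_ball] at hx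
    obtain ⟨h1, -⟩ := hχone x (hx.trans (by linarith))
    have hχx : χ x = 1 := χ.one_of_mem_closedBall (by rw [mem_closedBall, hχin]; linarith)
    have hne : x - (xbar + δ • lastUnit n) ≠ 0 := sub_pole_ne_zero (by linarith)
    have hgrad := (eventually_gradient_cutoffDipole hχ hδ hin.le).self_of_nhds
    dsimp only at hgrad
    rw [hgrad, h1, hχx, one_smul, smul_zero, add_zero, inner_dipoleGrad hne, inner_sub_pole, hin,
      normSqPow]
    have hnorm : ‖x - (xbar + δ • lastUnit n)‖ ^ 2 = ‖x - xbar‖ ^ 2 + δ ^ 2 := by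
      rw [← sub_sub, norm_sub_sq_real, inner_smul_right, real_inner_comm, hin, norm_smul,
        norm_lastUnit, Real.norm_of_nonneg hδ.le]
      ring
    rw [hnorm]
    have hd : ‖x - xbar‖ ^ 2 ≤ δ ^ 2 / 4 := by
      rw [dist_eq_norm] at hx
      nlinarith [norm_nonneg (x - xbar)]
    have hn' : (1 : ℝ) ≤ n := by exact_mod_cast hn
    have hpow : (5 / 4 : ℝ) ^ (-((n : ℝ) + 1) / 2 - 1) * δ ^ (2 * (-((n : ℝ) + 1) / 2 - 1)) ≤
        (‖x - xbar‖ ^ 2 + δ ^ 2) ^ (-((n : ℝ) + 1) / 2 - 1) := by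
      rw [Real.rpow_mul hδ.le, ← Real.mul_rpow (by norm_num) (by positivity), Real.rpow_two]
      exact Real.rpow_le_rpow_of_nonpos (by positivity) (by linarith) (by linarith)
    have hδpow : δ ^ (2 * (-((n : ℝ) + 1) / 2 - 1)) * δ ^ 2 = 1 / δ ^ (n + 1) := by
      rw [← Real.rpow_natCast δ 2, ← Real.rpow_add hδ, one_div, ← Real.rpow_natCast,
        ← Real.rpow_neg hδ.le]
      congr 1; push_cast; ring
    -- Here `n ≥ 1` gives the sign: `|x - x̄|² ≤ δ²/4` and `(n + 1) δ² ≥ 2 δ²`.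
    have hfac : ‖x - xbar‖ ^ 2 + δ ^ 2 - (n + 1) * (0 - δ) ^ 2 ≤ -(3 / 4 * δ ^ 2) := by
      nlinarith [sq_nonneg δ]
    calc _ ≤ (‖x - xbar‖ ^ 2 + δ ^ 2) ^ (-((n : ℝ) + 1) / 2 - 1) * -(3 / 4 * δ ^ 2) := by
          gcongr
      _ ≤ (5 / 4 : ℝ) ^ (-((n : ℝ) + 1) / 2 - 1) * δ ^ (2 * (-((n : ℝ) + 1) / 2 - 1)) *
          -(3 / 4 * δ ^ 2) :=
          mul_le_mul_of_nonpos_right hpow (by linarith [sq_nonneg δ])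
      _ = -(3 / 4 * (5 / 4 : ℝ) ^ (-((n : ℝ) + 1) / 2 - 1) *
          (δ ^ (2 * (-((n : ℝ) + 1) / 2 - 1)) * δ ^ 2)) := by ring
      _ = _ := by rw [hδpow]; ring

/-! ### Dirichlet data concentrated at the boundary point -/

theorem enorm_tangentialGradient_le (ψ : Space n → ℝ) (x : Space n) :
    ‖tangentialGradient Ω ψ x‖ₑ ≤ ‖gradient ψ x‖ₑ := by
  rw [enorm_le_iff_norm_le]
  exact Submodule.norm_starProjection_apply_le _ _

theorem smoothBoundaryH1Norm_le (hΩ : IsBoundedLipschitzDomain Ω) {ψ : Space n → ℝ} {M L : ℝ}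
    (hM : ∀ x, |ψ x| ≤ M) (hL : ∀ x, ‖gradient ψ x‖ ≤ L) {B : Set (Space n)}
    (hB : MeasurableSet B) (hB0 : ∀ x ∉ B, gradient ψ x = 0) :
    smoothBoundaryH1Norm Ω ψ ≤ ENNReal.ofReal
      √(M ^ 2 * (surfaceMeasure Ω).real univ + L ^ 2 * (surfaceMeasure Ω).real B) := by
  have := isFiniteMeasure_surfaceMeasure hΩ
  have hM0 : 0 ≤ M := (abs_nonneg _).trans (hM 0)
  have hL0 : 0 ≤ L := (norm_nonneg _).trans (hL 0)
  have hint : ∫⁻ x, (‖ψ x‖ₑ ^ 2 + ‖tangentialGradient Ω ψ x‖ₑ ^ 2) ∂(surfaceMeasure Ω) ≤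
      ENNReal.ofReal (M ^ 2 * (surfaceMeasure Ω).real univ +
        L ^ 2 * (surfaceMeasure Ω).real B) := by
    calc _ ≤ ∫⁻ x, (ENNReal.ofReal (M ^ 2) +
          B.indicator (fun _ => ENNReal.ofReal (L ^ 2)) x) ∂(surfaceMeasure Ω) := by
          refine lintegral_mono fun x => add_le_add ?_ ?_
          · rw [Real.enorm_eq_ofReal_abs, ← ENNReal.ofReal_pow (abs_nonneg _)]
            exact ENNReal.ofReal_le_ofReal (pow_le_pow_left₀ (abs_nonneg _) (hM x) 2)
          · by_cases hx : x ∈ B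
            · rw [indicator_of_mem hx, ENNReal.ofReal_pow hL0]
              refine pow_le_pow_left₀ zero_le ((enorm_tangentialGradient_le ψ x).trans ?_) 2
              rw [← ofReal_norm]
              exact ENNReal.ofReal_le_ofReal (hL x)
            · have h0 := enorm_tangentialGradient_le (Ω := Ω) ψ x
              rw [hB0 x hx, enorm_zero, nonpos_iff_eq_zero] at h0
              rw [h0]
              simp
      _ = _ := by
          rw [lintegral_add_left measurable_const, lintegral_const, lintegral_indicator_const hB,
            ENNReal.ofReal_add (by positivity) (by positivity),
            ENNReal.ofReal_mul (by positivity), ENNReal.ofReal_mul (by positivity),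
            ofReal_measureReal, ofReal_measureReal]
  rw [smoothBoundaryH1Norm, Real.sqrt_eq_rpow, ← ENNReal.ofReal_rpow_of_nonneg (by positivity)
    (by norm_num)]
  exact ENNReal.rpow_le_rpow hint (by norm_num)

theorem mem_dirichletClass_of_contDiff (hΩ : IsBoundedLipschitzDomain Ω) {ψ : Space n → ℝ}
    (hψ : ContDiff ℝ ∞ ψ) {g_low g_up C_G : ℝ} (hb : ∀ x, g_low ≤ ψ x ∧ ψ x ≤ g_up)
    (hC : smoothBoundaryH1Norm Ω ψ ≤ ENNReal.ofReal C_G) :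
    ψ ∈ dirichletClass Ω g_low g_up C_G := by
  have := isFiniteMeasure_surfaceMeasure hΩ
  refine ⟨⟨smoothBoundaryH1Norm Ω ψ, ⟨?_, fun _ => ψ, fun _ => hψ, by simp, ?_,
    tendsto_const_nhds⟩, hC⟩, Eventually.of_forall hb⟩
  · refine MemLp.of_bound hψ.continuous.aestronglyMeasurable (max |g_low| |g_up|)
      (Eventually.of_forall fun x => ?_)
    exact abs_le_max_abs_abs (hb x).1 (hb x).2
  · have h0 : gradient (fun _ : Space n => (0 : ℝ)) = fun _ => 0 := by
      ext1 x; exact gradient_fun_const x 0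
    have : smoothBoundaryH1Norm Ω (fun _ => (0 : ℝ)) = 0 := by
      simp [smoothBoundaryH1Norm, tangentialGradient, h0]
    simp [this]

/-- The Dirichlet datum `s + h β((x - x̄)/δ)`. -/
def bumpDatum (β : Space n → ℝ) (xbar : Space n) (s h δ : ℝ) (x : Space n) : ℝ :=
  s + h * β (δ⁻¹ • (x - xbar))

theorem gradient_bumpDatum {β : Space n → ℝ} (hβ : ContDiff ℝ ∞ β) (s h δ : ℝ) (x : Space n) :
    gradient (bumpDatum β xbar s h δ) x = (h * δ⁻¹) • gradient β (δ⁻¹ • (x - xbar)) := by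
  have h1 : HasFDerivAt (fun x : Space n => δ⁻¹ • (x - xbar))
      (δ⁻¹ • ContinuousLinearMap.id ℝ (Space n)) x :=
    ((hasFDerivAt_id x).sub_const xbar).const_smul δ⁻¹
  have h2 := (hβ.differentiable (by simp) (δ⁻¹ • (x - xbar))).hasFDerivAt.comp x h1
  refine gradient_eq_of_hasFDerivAt (((h2.const_mul h).const_add s).congr_fderiv ?_)
  ext v
  simp
  ring

theorem surfaceMeasure_real_ball (hΩ : IsBoundedLipschitzDomain Ω) (hflat : IsFlatPart Ω xbar ε₀)
    {ρ : ℝ} (hρ0 : 0 < ρ) (hρ : ρ ≤ ε₀) : (surfaceMeasure Ω).real (ball xbar ρ) =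
      ρ ^ n * volume.real (ball (0 : EuclideanSpace ℝ (Fin n)) 1) := by
  rw [Measure.real, surfaceMeasure_ball hΩ hflat hρ, Measure.addHaar_ball_of_pos _ _ hρ0,
    ENNReal.toReal_mul, ENNReal.toReal_ofReal (by positivity), finrank_euclideanSpace_fin]
  rfl

/-- Bumps of width `δ` and height `O(√δ)` are admissible Dirichlet data. -/
theorem exists_datum (hn : 1 ≤ n) (hΩ : IsBoundedLipschitzDomain Ω)
    (hflat : IsFlatPart Ω xbar ε₀) :
    ∃ κ : ℝ, 0 < κ ∧ ∀ s δ M : ℝ, 0 < δ → δ ≤ 1 → δ ≤ ε₀ → |s| ≤ M → |s + κ * √δ| ≤ M →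
      ∃ g : Space n → ℝ, ContDiff ℝ ∞ g ∧ (∀ x, s ≤ g x ∧ g x ≤ s + κ * √δ) ∧
        (∀ x ∈ ball xbar (δ / 4), g x = s + κ * √δ) ∧ (∀ x ∉ ball xbar (δ / 2), g x = s) ∧
        smoothBoundaryH1Norm Ω g ≤
          ENNReal.ofReal √(M ^ 2 * (surfaceMeasure Ω).real univ + 1) := by
  obtain ⟨β, hβin, hβout⟩ : ∃ β : ContDiffBump (0 : Space n), β.rIn = 1 / 4 ∧ β.rOut = 1 / 2 :=
    ⟨⟨1 / 4, 1 / 2, by norm_num, by norm_num⟩, rfl, rfl⟩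
  have hβ : ContDiff ℝ ∞ β := β.contDiff
  have hβc : HasCompactSupport β := β.hasCompactSupport
  obtain ⟨K, hK⟩ := (continuous_gradient hβ).bounded_above_of_compact_support
    (hasCompactSupport_gradient hβc)
  have hK0 : 0 ≤ K := (norm_nonneg _).trans (hK 0)
  set w : ℝ := volume.real (ball (0 : EuclideanSpace ℝ (Fin n)) 1) with hw
  have hw0 : 0 ≤ w := measureReal_nonneg
  -- With `h = κ √δ` the gradient is at most `κ K δ^{-1/2}` on a set of measure `δ^n w`, so that its squared
  -- `L²` norm is at most `κ² K² w δ^{n-1} ≤ 1`.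
  have hκ0 : 0 < (√(K ^ 2 * w + 1))⁻¹ := by positivity
  have hκsq : (√(K ^ 2 * w + 1))⁻¹ ^ 2 * (K ^ 2 * w) ≤ 1 := by
    rw [inv_pow, Real.sq_sqrt (by positivity), inv_mul_le_iff₀ (by positivity)]
    linarith
  set κ := (√(K ^ 2 * w + 1))⁻¹ with hκ
  refine ⟨κ, hκ0, fun s δ M hδ hδ1 hδε hs hs' =>
    ⟨bumpDatum β xbar s (κ * √δ) δ, ?_, ?_, ?_, ?_, ?_⟩⟩
  · exact contDiff_const.add (contDiff_const.mul
      (hβ.comp ((contDiff_id.sub contDiff_const).const_smul _)))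
  · intro x
    have h0 := β.nonneg (x := δ⁻¹ • (x - xbar))
    have h1 := β.le_one (x := δ⁻¹ • (x - xbar))
    have h2 : 0 ≤ κ * √δ := by positivity
    constructor <;> simp only [bumpDatum] <;> nlinarith
  · intro x hx
    rw [bumpDatum, β.one_of_mem_closedBall, mul_one]
    rw [mem_closedBall_zero_iff, hβin, norm_smul, norm_inv, Real.norm_of_nonneg hδ.le,
      inv_mul_le_iff₀ hδ, ← dist_eq_norm]
    linarith [mem_ball.1 hx]
  · intro x hx
    rw [bumpDatum, β.zero_of_le_dist, mul_zero, add_zero]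
    rw [dist_zero_right, hβout, norm_smul, norm_inv, Real.norm_of_nonneg hδ.le,
      le_inv_mul_iff₀ hδ, ← dist_eq_norm]
    linarith [not_lt.1 fun h => hx (mem_ball.2 h)]
  · refine (smoothBoundaryH1Norm_le hΩ (M := M) (L := κ * √δ * δ⁻¹ * K) (fun x => ?_) (fun x => ?_)
      (B := ball xbar δ) measurableSet_ball (fun x hx => ?_)).trans
      (ENNReal.ofReal_le_ofReal (Real.sqrt_le_sqrt ?_))
    · have h0 := β.nonneg (x := δ⁻¹ • (x - xbar))
      have h1 := β.le_one (x := δ⁻¹ • (x - xbar))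
      have h2 : 0 ≤ κ * √δ := by positivity
      rw [abs_le] at hs hs' ⊢
      constructor <;> simp only [bumpDatum] <;> nlinarith
    · rw [gradient_bumpDatum hβ, norm_smul, Real.norm_of_nonneg (by positivity)]
      gcongr
      exact hK _
    · rw [gradient_bumpDatum hβ, image_eq_zero_of_notMem_tsupport (f := gradient β), smul_zero]
      intro h
      have h' := tsupport_gradient_subset _ h
      rw [β.tsupport_eq, mem_closedBall_zero_iff, hβout, norm_smul, norm_inv,
        Real.norm_of_nonneg hδ.le, inv_mul_le_iff₀ hδ, ← dist_eq_norm] at h'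
      exact hx (mem_ball.2 (by linarith))
    · rw [surfaceMeasure_real_ball hΩ hflat hδ hδε, ← hw]
      gcongr
      obtain ⟨m, rfl⟩ : ∃ m, n = m + 1 := ⟨n - 1, by omega⟩
      have hm : δ ^ m ≤ 1 := pow_le_one₀ hδ.le hδ1
      calc _ = κ ^ 2 * (K ^ 2 * w) * (√δ ^ 2 * δ⁻¹ ^ 2 * δ ^ (m + 1)) := by ring
        _ = κ ^ 2 * (K ^ 2 * w) * δ ^ m := by
            rw [Real.sq_sqrt hδ.le]; field_simp; ring
        _ ≤ 1 * 1 := by gcongr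
        _ = 1 := one_mul 1

/-! ### Distinct coefficients have distinct fluxes -/

/-- Comparison of the orders `δ^{-1/2}` and `δ^{-1/4}` as `δ → 0`. -/
theorem le_zero_of_rpow_bound {c P Q δ₀ : ℝ} (hδ₀ : 0 < δ₀) (hP : 0 ≤ P) (hQ : 0 ≤ Q)
    (h : ∀ δ : ℝ, 0 < δ → δ ≤ δ₀ →
      c * δ ^ (-(1 / 2) : ℝ) ≤ P + Q * δ ^ (-(1 / 4) : ℝ)) : c ≤ 0 := by
  by_contra! hc
  obtain ⟨τ, hτ, hτ1, hτδ, hτc⟩ : ∃ τ : ℝ, 0 < τ ∧ τ ≤ 1 ∧ τ ≤ δ₀ ∧ (P + Q + 1) * τ ≤ c := by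
    refine ⟨min (min 1 δ₀) (c / (P + Q + 1)), by positivity,
      (min_le_left _ _).trans (min_le_left _ _), (min_le_left _ _).trans (min_le_right _ _), ?_⟩
    rw [mul_comm, ← le_div_iff₀ (by positivity)]
    exact min_le_right _ _
  -- For `δ = τ⁴` the bound reads `c ≤ P τ² + Q τ`, and `P τ² + Q τ < (P + Q + 1) τ ≤ c`.
  have h4 : τ ^ 4 ≤ τ := pow_le_of_le_one hτ.le hτ1 (by norm_num)
  have hpow : ∀ r : ℝ, (τ ^ 4) ^ r = τ ^ (4 * r) := fun r => by
    rw [← Real.rpow_natCast, ← Real.rpow_mul hτ.le]; norm_num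
  have := h (τ ^ 4) (by positivity) (h4.trans hτδ)
  have e1 : τ ^ (4 * (-(1 / 2)) : ℝ) = (τ ^ 2)⁻¹ := by
    rw [show (4 * (-(1 / 2)) : ℝ) = -(2 : ℕ) by norm_num, Real.rpow_neg hτ.le, Real.rpow_natCast]
  have e2 : τ ^ (4 * (-(1 / 4)) : ℝ) = τ⁻¹ := by
    rw [show (4 * (-(1 / 4)) : ℝ) = -1 by norm_num, Real.rpow_neg_one]
  rw [hpow, hpow, e1, e2] at this
  have h5 := mul_le_mul_of_nonneg_right this (sq_nonneg τ)
  have e3 : c * (τ ^ 2)⁻¹ * τ ^ 2 = c := by field_simp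
  have e4 : (P + Q * τ⁻¹) * τ ^ 2 = P * τ ^ 2 + Q * τ := by field_simp
  rw [e3, e4] at h5
  nlinarith [mul_le_mul_of_nonneg_left hτ1 hτ.le]

/-- A primitive `A` of `f` vanishing at `s`, where `f s ≠ 0`, grows linearly to the right of `s`, with the
sign of `f s`. -/
theorem exists_primitive_lower_bound {f A : ℝ → ℝ} (hf : Continuous f)
    (hA : ∀ t, HasDerivAt A (f t) t) {s : ℝ} (hAs : A s = 0) (hfs : f s ≠ 0) :
    ∃ η : ℝ, 0 < η ∧ ∀ t ∈ Icc s (s + η), f s ^ 2 / 2 * (t - s) ≤ f s * A t := by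
  have hpos : 0 < f s ^ 2 := by positivity
  have hev : ∀ᶠ t in 𝓝 s, f s ^ 2 / 2 < f s * f t :=
    (hf.tendsto s).const_mul (f s) |>.eventually (lt_mem_nhds (by nlinarith))
  obtain ⟨η, hη, hball⟩ := Metric.eventually_nhds_iff.1 hev
  refine ⟨η / 2, by positivity, fun t ht => ?_⟩
  have hd : ∀ t, HasDerivAt (fun t => f s * A t) (f s * f t) t := fun t => (hA t).const_mul _
  have := (convex_Icc s (s + η / 2)).mul_sub_le_image_sub_of_le_deriv
    (f := fun t => f s * A t) (C := f s ^ 2 / 2)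
    (fun x _ => (hd x).continuousAt.continuousWithinAt)
    (fun x _ => (hd x).differentiableAt.differentiableWithinAt)
    (fun x hx => by
      rw [(hd x).deriv]
      have hx' := interior_subset hx
      refine (hball ?_).le
      rw [Real.dist_eq, abs_of_nonneg (by linarith [hx'.1])]
      linarith [hx'.2])
    s ⟨le_rfl, by linarith⟩ t ht ht.1
  simpa [hAs] using this

theorem integral_abs_primitive_le (hΩ : IsBoundedLipschitzDomain Ω) {A : ℝ → ℝ} {C C_U : ℝ}
    (hC : 0 ≤ C) (hA : LipschitzWith C.toNNReal A) {s : ℝ} (hAs : A s = 0) {u : SobolevH1 Ω}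
    (hu : u.norm ≤ C_U) :
    ∫ x in Ω, |A (u.toFun x)| ≤ C * ((1 + |s|) * volume.real Ω + C_U ^ 2) := by
  have := isFiniteMeasure_restrict hΩ
  have hi : Integrable (fun x => |u.toFun x|) (volume.restrict Ω) :=
    (u.memLp_toFun.integrable (by norm_num)).norm
  have h1 := SobolevH1.integral_abs_le hΩ hu
  calc ∫ x in Ω, |A (u.toFun x)| ≤ ∫ x in Ω, C * (|u.toFun x| + |s|) := by
        refine integral_mono (integrable_lipschitz_comp hA u.memLp_toFun).norm
          ((hi.add (integrable_const _)).const_mul _) fun x => ?_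
        have h2 := hA.dist_le_mul (u.toFun x) s
        rw [Real.dist_eq, Real.dist_eq, hAs, sub_zero, Real.coe_toNNReal _ hC] at h2
        exact h2.trans (by gcongr; exact abs_sub _ _)
    _ = C * ((∫ x in Ω, |u.toFun x|) + |s| * volume.real Ω) := by
        rw [integral_const_mul, integral_add hi (integrable_const _)]
        simp [mul_comm]
    _ ≤ _ := mul_le_mul_of_nonneg_left (by linarith) hC

/-- Up to `L¹` bounds, the flux tested against `φ` is a boundary integral of the primitive of `a`
against the normal derivative of `φ`. -/
theorem Coefficients.IsAdmissible.abs_flux_sub_boundary_le {P : Coefficients n} {C_A C_U : ℝ}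
    (hP : P.IsAdmissible Ω C_A) (hΩ : IsBoundedLipschitzDomain Ω) (hflat : IsFlatPart Ω xbar ε₀)
    {A : ℝ → ℝ} (hA : ∀ t, HasDerivAt A (P.a t) t) {s : ℝ} (hAs : A s = 0)
    {u : SobolevH1 Ω} {g : Space n → ℝ} (hu : u.norm ≤ C_U) (hg : HasTrace u g)
    {φ : Space n → ℝ} (hφ : ContDiff ℝ ∞ φ) (hφc : HasCompactSupport φ)
    (hφs : tsupport φ ⊆ ball xbar ε₀) {K W : ℝ} (hK : ∀ x ∈ Ω, |divergence (gradient φ) x| ≤ K)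
    (hW : ∫ x in Ω, (‖gradient φ x‖ + |φ x|) ≤ W) :
    |P.flux u (SobolevH1.ofSmooth Ω φ hφ hφc) -
      ∫ x, A (g x) * ⟪lastUnit n, gradient φ x⟫_ℝ ∂(surfaceMeasure Ω)| ≤
      C_A * W + C_A * ((1 + |s|) * volume.real Ω + C_U ^ 2) * K := by
  have := isFiniteMeasure_restrict hΩ
  have haC : ∀ t, |P.a t| ≤ C_A := fun t => hP.a_mem.2.1 t (mem_univ t)
  have hC : 0 ≤ C_A := (abs_nonneg _).trans (haC 0)
  have hAL := lipschitzWith_of_hasDerivAt hA haC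
  have hgreen := integral_primitive_of_hasTrace hΩ hflat (continuousOn_univ.1 hP.a_mem.1) haC hA hg
    (contDiff_gradient hφ) ((tsupport_gradient_subset φ).trans hφs)
  have hlow := hP.abs_flux_sub_le hΩ u (SobolevH1.ofSmooth Ω φ hφ hφc)
  have hlow' := hlow.trans (mul_le_mul_of_nonneg_left hW hC)
  obtain ⟨x₀, hx₀⟩ := hΩ.isConnected.nonempty
  have hK0 : 0 ≤ K := (abs_nonneg _).trans (hK x₀ hx₀)
  have hT : |∫ x in Ω, A (u.toFun x) * divergence (gradient φ) x| ≤
      C_A * ((1 + |s|) * volume.real Ω + C_U ^ 2) * K := by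
    have h1 : |∫ x in Ω, A (u.toFun x) * divergence (gradient φ) x| ≤
        ∫ x in Ω, |A (u.toFun x)| * K := by
      rw [← Real.norm_eq_abs]
      refine norm_integral_le_of_norm_le
        ((integrable_lipschitz_comp hAL u.memLp_toFun).norm.mul_const K) ?_
      filter_upwards [ae_restrict_mem hΩ.isOpen.measurableSet] with x hx
      rw [norm_mul]
      exact mul_le_mul_of_nonneg_left (hK x hx) (norm_nonneg _)
    rw [integral_mul_const] at h1
    exact h1.trans (mul_le_mul_of_nonneg_right (integral_abs_primitive_le hΩ hC hAL hAs hu) hK0)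
  rw [← hgreen]
  calc _ = |(P.flux u (SobolevH1.ofSmooth Ω φ hφ hφc) -
        ∫ x in Ω, P.a (u.toFun x) * ⟪u.grad x, gradient φ x⟫_ℝ) -
        ∫ x in Ω, A (u.toFun x) * divergence (gradient φ) x| := by congr 1; ring
    _ ≤ _ := (abs_sub _ _).trans (add_le_add hlow' hT)

/-- If `a₁` and `a₂` differ at a point between the bounds for the data, then the boundary measurements
distinguish them. -/
theorem exists_not_fluxesAgreeOn (hn : 1 ≤ n) (hΩ : IsBoundedLipschitzDomain Ω)
    (hflat : IsFlatPart Ω xbar ε₀) {g_low g_up C_G C_A C_U : ℝ} {P₁ P₂ : Coefficients n}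
    {u₁ u₂ : (Space n → ℝ) → SobolevH1 Ω}
    (hP₁ : P₁.IsAdmissible Ω C_A) (hP₂ : P₂.IsAdmissible Ω C_A)
    (hS₁ : P₁.IsUniformlySolvable Ω (dirichletClass Ω g_low g_up C_G) C_U)
    (hS₂ : P₂.IsUniformlySolvable Ω (dirichletClass Ω g_low g_up C_G) C_U)
    (hu : ∀ g ∈ dirichletClass Ω g_low g_up C_G,
      P₁.IsWeakSolution (u₁ g) g ∧ P₂.IsWeakSolution (u₂ g) g)
    (hC₀ : √(max |g_low| |g_up| ^ 2 * (surfaceMeasure Ω).real univ + 1) ≤ C_G)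
    {s : ℝ} (hs : s ∈ Ioo g_low g_up) (hne : P₁.a s ≠ P₂.a s) :
    ∃ g ∈ dirichletClass Ω g_low g_up C_G,
      ¬ FluxesAgreeOn (accessiblePart Ω xbar ε₀) (P₁.flux (u₁ g)) (P₂.flux (u₂ g)) := by
  by_contra! hagree
  have hε := hflat.pos
  have := isFiniteMeasure_surfaceMeasure hΩ
  have ha₁ : Continuous P₁.a := continuousOn_univ.1 hP₁.a_mem.1
  have ha₂ : Continuous P₂.a := continuousOn_univ.1 hP₂.a_mem.1
  have hC : 0 ≤ C_A := (norm_nonneg _).trans (hP₁.a_mem.2.1 0 (mem_univ 0))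
  set A₁ : ℝ → ℝ := fun t => ∫ r in s..t, P₁.a r with hA₁def
  set A₂ : ℝ → ℝ := fun t => ∫ r in s..t, P₂.a r with hA₂def
  have hA₁ : ∀ t, HasDerivAt A₁ (P₁.a t) t := fun t =>
    intervalIntegral.integral_hasDerivAt_right (ha₁.intervalIntegrable _ _)
      (ha₁.stronglyMeasurableAtFilter _ _) ha₁.continuousAt
  have hA₂ : ∀ t, HasDerivAt A₂ (P₂.a t) t := fun t =>
    intervalIntegral.integral_hasDerivAt_right (ha₂.intervalIntegrable _ _)
      (ha₂.stronglyMeasurableAtFilter _ _) ha₂.continuousAt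
  have hA₁s : A₁ s = 0 := intervalIntegral.integral_same
  have hA₂s : A₂ s = 0 := intervalIntegral.integral_same
  set m : ℝ := P₁.a s - P₂.a s with hm
  have hm0 : m ≠ 0 := sub_ne_zero.2 hne
  obtain ⟨η, hη, hlowA⟩ := exists_primitive_lower_bound (A := fun t => A₁ t - A₂ t)
    (f := fun t => P₁.a t - P₂.a t) (ha₁.sub ha₂) (fun t => (hA₁ t).sub (hA₂ t)) (s := s)
    (by simp [hA₁s, hA₂s]) hm0
  obtain ⟨κ, hκ, hdatum⟩ := exists_datum hn hΩ hflat
  obtain ⟨K, c, hc, htest⟩ := exists_testFunction hn hΩ hflat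
  set w : ℝ := volume.real (ball (0 : EuclideanSpace ℝ (Fin n)) 1) with hw
  have hw0 : 0 < w := ENNReal.toReal_pos (measure_ball_pos _ _ one_pos).ne'
    measure_ball_lt_top.ne
  -- The width `δ` is so small that the bump has height at most `η` and stays below `g_up`.
  set δ₀ : ℝ := min (min 1 (ε₀ / 8)) ((min η (g_up - s) / κ) ^ 2) with hδ₀
  have hgap : 0 < g_up - s := sub_pos.2 hs.2
  have hδ₀pos : 0 < δ₀ := by positivity
  set T : ℝ := C_A * ((1 + |s|) * volume.real Ω + C_U ^ 2) * |K| with hT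
  have hT0 : 0 ≤ T := by positivity
  have hmain : ∀ δ : ℝ, 0 < δ → δ ≤ δ₀ →
      (m ^ 2 / 2 * κ * c * w / 4 ^ n) * δ ^ (-(1 / 2) : ℝ) ≤
        |m| * (2 * T) + (|m| * (2 * (C_A * |K|))) * δ ^ (-(1 / 4) : ℝ) := by
    intro δ hδ hδle
    have hδ1 : δ ≤ 1 := hδle.trans ((min_le_left _ _).trans (min_le_left _ _))
    have hδ8 : δ ≤ ε₀ / 8 := hδle.trans ((min_le_left _ _).trans (min_le_right _ _))
    have hh : κ * √δ ≤ min η (g_up - s) := by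
      have h1 : √δ ≤ min η (g_up - s) / κ := by
        rw [Real.sqrt_le_left (by positivity)]
        exact hδle.trans (min_le_right _ _)
      rw [le_div_iff₀ hκ] at h1
      linarith
    have hhη : κ * √δ ≤ η := hh.trans (min_le_left _ _)
    have hhg : κ * √δ ≤ g_up - s := hh.trans (min_le_right _ _)
    have hh0 : 0 ≤ κ * √δ := by positivity
    obtain ⟨g, hg, hgb, hgin, hgout, hgN⟩ := hdatum s δ (max |g_low| |g_up|) hδ hδ1 (by linarith)
      (abs_le_max_abs_abs hs.1.le hs.2.le)
      (abs_le_max_abs_abs (by linarith [hs.1]) (by linarith))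
    obtain ⟨φ, hφ, hφs, hφK, hφW, hφn⟩ := htest δ hδ hδ8
    have hφc : HasCompactSupport φ :=
      IsCompact.of_isClosed_subset (isCompact_closedBall xbar ε₀) (isClosed_tsupport φ)
        (hφs.trans ball_subset_closedBall)
    have hgG : g ∈ dirichletClass Ω g_low g_up C_G :=
      mem_dirichletClass_of_contDiff hΩ hg
        (fun x => ⟨by linarith [(hgb x).1, hs.1], by linarith [(hgb x).2]⟩)
        (hgN.trans (ENNReal.ofReal_le_ofReal hC₀))
    have hflux := hagree g hgG (SobolevH1.ofSmooth Ω φ hφ hφc) φ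
      (SobolevH1.hasTrace_ofSmooth hΩ hφ hφc) (by
        filter_upwards [ae_restrict_mem isClosed_frontier.measurableSet] with x hx hxΓ
        exact image_eq_zero_of_notMem_tsupport fun h => hxΓ ⟨hφs h, hx⟩)
    have hφK' : ∀ x ∈ Ω, |divergence (gradient φ) x| ≤ |K| := fun x hx =>
      (hφK x hx).trans (le_abs_self K)
    have hφW' : ∫ x in Ω, (‖gradient φ x‖ + |φ x|) ≤ |K| * δ ^ (-(1 / 4) : ℝ) :=
      hφW.trans (by gcongr; exact le_abs_self K)
    have e₁ := hP₁.abs_flux_sub_boundary_le hΩ hflat hA₁ hA₁s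
      ((hS₁ g hgG).2 _ (hu g hgG).1) (hu g hgG).1.1 hφ hφc hφs hφK' hφW'
    have e₂ := hP₂.abs_flux_sub_boundary_le hΩ hflat hA₂ hA₂s
      ((hS₂ g hgG).2 _ (hu g hgG).2) (hu g hgG).2.1 hφ hφc hφs hφK' hφW'
    have hgm : MemLp g 2 (surfaceMeasure Ω) := (hu g hgG).1.1.1
    have hV := contDiff_gradient hφ
    obtain ⟨M, hM⟩ := hV.continuous.bounded_above_of_compact_support
      (hasCompactSupport_gradient hφc)
    have hVe : ∀ x, |⟪lastUnit n, gradient φ x⟫_ℝ| ≤ M := fun x =>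
      (abs_inner_lastUnit_le _).trans (hM x)
    have i₁ := integrable_lipschitz_comp_mul
      (lipschitzWith_of_hasDerivAt hA₁ fun t => hP₁.a_mem.2.1 t (mem_univ t)) hgm
      (continuous_const.inner hV.continuous).aestronglyMeasurable hVe
    have i₂ := integrable_lipschitz_comp_mul
      (lipschitzWith_of_hasDerivAt hA₂ fun t => hP₂.a_mem.2.1 t (mem_univ t)) hgm
      (continuous_const.inner hV.continuous).aestronglyMeasurable hVe
    set B₁ := ∫ x, A₁ (g x) * ⟪lastUnit n, gradient φ x⟫_ℝ ∂(surfaceMeasure Ω) with hB₁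
    set B₂ := ∫ x, A₂ (g x) * ⟪lastUnit n, gradient φ x⟫_ℝ ∂(surfaceMeasure Ω) with hB₂
    have hupper : |B₁ - B₂| ≤ 2 * (C_A * (|K| * δ ^ (-(1 / 4) : ℝ)) + T) := by
      rw [hflux] at e₁
      rw [abs_sub_comm] at e₁
      have := abs_add_le (B₁ - P₂.flux (u₂ g) (SobolevH1.ofSmooth Ω φ hφ hφc))
        (P₂.flux (u₂ g) (SobolevH1.ofSmooth Ω φ hφ hφc) - B₂)
      rw [sub_add_sub_cancel] at this
      linarith
    -- The integrand has a sign: it vanishes off `B_{δ/2}(x̄)`, where `g = s`, and on `B_{δ/4}(x̄)` it is at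
    -- least `(m²/2) (κ √δ) c δ^{-d}`.
    have hlower : m ^ 2 / 2 * (κ * √δ) * (c / δ ^ (n + 1)) * ((δ / 4) ^ n * w) ≤
        -(m * (B₁ - B₂)) := by
      rw [hB₁, hB₂, ← integral_sub i₁ i₂, ← integral_const_mul, ← integral_neg,
        hw, ← surfaceMeasure_real_ball hΩ hflat (by positivity) (by linarith : δ / 4 ≤ ε₀),
        mul_comm _ (Measure.real _ _), ← smul_eq_mul, ← integral_indicator_const _
          measurableSet_ball]
      refine integral_mono_ae ((integrable_const _).indicator measurableSet_ball)
        ((i₁.sub i₂).const_mul m).neg ?_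
      filter_upwards [ae_restrict_mem isClosed_frontier.measurableSet] with x hx
      have hval : -(m * (A₁ (g x) * ⟪lastUnit n, gradient φ x⟫_ℝ -
          A₂ (g x) * ⟪lastUnit n, gradient φ x⟫_ℝ)) =
          m * (A₁ (g x) - A₂ (g x)) * -⟪lastUnit n, gradient φ x⟫_ℝ := by ring
      simp only [hval]
      by_cases hxb : x ∈ ball xbar (δ / 2)
      · have hcont : Continuous fun x : Space n => ⟪lastUnit n, x - xbar⟫_ℝ := by fun_prop
        have h0 := frontier_inter_ball_graph hΩ.isOpen isOpen_ball hcont hflat.flat hx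
          (ball_subset_ball (by linarith) hxb)
        have hn' := hφn x hxb h0
        have hcpos : 0 ≤ c / δ ^ (n + 1) := by positivity
        have hA := hlowA (g x) ⟨(hgb x).1, (hgb x).2.trans (by linarith)⟩
        have hA0 : 0 ≤ m ^ 2 / 2 * (g x - s) :=
          mul_nonneg (by positivity) (by linarith [(hgb x).1])
        by_cases hx4 : x ∈ ball xbar (δ / 4)
        · rw [indicator_of_mem hx4]
          have hgx : g x - s = κ * √δ := by rw [hgin x hx4]; ring
          rw [← hgx]
          exact mul_le_mul hA (by linarith) hcpos (hA0.trans hA)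
        · rw [indicator_of_notMem hx4]
          exact mul_nonneg (hA0.trans hA) (by linarith)
      · rw [hgout x hxb, hA₁s, hA₂s, indicator_of_notMem fun h =>
          hxb (ball_subset_ball (by linarith) h)]
        simp
    have hscale : √δ / δ ^ (n + 1) * δ ^ n = δ ^ (-(1 / 2) : ℝ) := by
      have h1 : δ ^ (-(1 / 2) : ℝ) = (√δ)⁻¹ := by
        rw [Real.rpow_neg hδ.le, Real.sqrt_eq_rpow]
      have h2 : √δ * √δ = δ := Real.mul_self_sqrt hδ.le
      have h3 : √δ ≠ 0 := (Real.sqrt_pos.2 hδ).ne'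
      rw [h1, pow_succ]
      field_simp
      linarith
    calc _ = m ^ 2 / 2 * (κ * √δ) * (c / δ ^ (n + 1)) * ((δ / 4) ^ n * w) := by
          rw [← hscale, div_pow]; ring
      _ ≤ |m * (B₁ - B₂)| := hlower.trans (neg_le_abs _)
      _ ≤ |m| * (2 * (C_A * (|K| * δ ^ (-(1 / 4) : ℝ)) + T)) := by
          rw [abs_mul]; gcongr
      _ = _ := by ring
  have hfinal := le_zero_of_rpow_bound hδ₀pos (by positivity) (by positivity) hmain
  have : 0 < m ^ 2 / 2 * κ * c * w / 4 ^ n := by positivity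
  linarith

/-! ### Equal coefficients have equal fluxes -/

/-- The weak gradient is determined almost everywhere by the function. -/
theorem ae_eq_of_hasWeakFDeriv (hΩ : IsOpen Ω) {f₁ f₂ : Space n → ℝ} {G₁ G₂ : Space n → Space n}
    (hG₁ : MemLp G₁ 2 (volume.restrict Ω)) (hG₂ : MemLp G₂ 2 (volume.restrict Ω))
    (h₁ : HasWeakFDeriv Ω f₁ (fun x => innerSL ℝ (G₁ x)))
    (h₂ : HasWeakFDeriv Ω f₂ (fun x => innerSL ℝ (G₂ x)))
    (hf : f₁ =ᵐ[volume.restrict Ω] f₂) : G₁ =ᵐ[volume.restrict Ω] G₂ := by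
  have hloc : ∀ {G : Space n → Space n}, MemLp G 2 (volume.restrict Ω) →
      LocallyIntegrableOn G Ω := fun hG =>
    locallyIntegrableOn_of_locallyIntegrable_restrict (hG.locallyIntegrable (by norm_num))
  have hint : ∀ {G : Space n → Space n}, MemLp G 2 (volume.restrict Ω) → ∀ η : Space n → ℝ,
      ContDiff ℝ ∞ η → HasCompactSupport η →
      Integrable (fun x => η x • G x) (volume.restrict Ω) := fun hG η hη hηc =>
    (hG.locallyIntegrable (by norm_num)).integrable_smul_left_of_hasCompactSupport
      hη.continuous hηc
  have key : ∀ᵐ x, x ∈ Ω → (G₁ - G₂) x = 0 := by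
    refine hΩ.ae_eq_zero_of_integral_contDiff_smul_eq_zero ((hloc hG₁).sub (hloc hG₂))
      fun η hη hηc hηΩ => ?_
    rw [← setIntegral_eq_integral_of_forall_compl_eq_zero (s := Ω) (fun x hx => by
      rw [image_eq_zero_of_notMem_tsupport fun h => hx (hηΩ h), zero_smul])]
    simp only [Pi.sub_apply, smul_sub]
    have i₁ := hint hG₁ η hη hηc
    have i₂ := hint hG₂ η hη hηc
    rw [integral_sub i₁ i₂, sub_eq_zero]
    refine ext_inner_left ℝ fun v => ?_
    rw [← integral_inner i₁, ← integral_inner i₂]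
    have e₁ := h₁ η hη hηc hηΩ v
    have e₂ := h₂ η hη hηc hηΩ v
    have e₃ : ∫ x in Ω, fderiv ℝ η x v • f₁ x = ∫ x in Ω, fderiv ℝ η x v • f₂ x :=
      integral_congr_ae (hf.mono fun x hx => by simp only [hx])
    rw [e₁, e₂, neg_inj] at e₃
    simp only [inner_smul_right]
    simpa [real_inner_comm v] using e₃
  rw [Filter.EventuallyEq, ae_restrict_iff' hΩ.measurableSet]
  exact key.mono fun x hx hxΩ => sub_eq_zero.1 (hx hxΩ)

theorem Coefficients.flux_congr {P₁ P₂ : Coefficients n} {u₁ u₂ : SobolevH1 Ω}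
    (h : ∀ᵐ x ∂(volume.restrict Ω),
      P₁.a (u₁.toFun x) • u₁.grad x + P₁.b x (u₁.toFun x) =
        P₂.a (u₂.toFun x) • u₂.grad x + P₂.b x (u₂.toFun x) ∧
      P₁.c x (u₁.toFun x) (u₁.grad x) = P₂.c x (u₂.toFun x) (u₂.grad x)) (φ : SobolevH1 Ω) :
    P₁.flux u₁ φ = P₂.flux u₂ φ :=
  integral_congr_ae (h.mono fun x hx => by simp only [hx.1, hx.2])

theorem eqOn_Icc_of_eqOn_Ioo {f g : ℝ → ℝ} (hf : Continuous f) (hg : Continuous g) {a b : ℝ}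
    (hab : a < b) (h : ∀ s ∈ Ioo a b, f s = g s) : ∀ s ∈ Icc a b, f s = g s := by
  have : Icc a b ⊆ {s | f s = g s} := by
    rw [← closure_Ioo hab.ne]
    exact (isClosed_eq hf hg).closure_subset_iff.2 h
  exact this

/-- If `u₂` is the unique solution of the second problem and the lower order terms agree, then
different fluxes can only come from different values of `a₁` and `a₂`. -/
theorem exists_ne_of_not_fluxesAgreeOn (hΩ : IsBoundedLipschitzDomain Ω) {Γ : Set (Space n)}
    {g_low g_up C_A : ℝ} {G : Set (Space n → ℝ)} {P₁ P₂ : Coefficients n}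
    (hP₁ : P₁.IsAdmissible Ω C_A) (hP₂ : P₂.IsAdmissible Ω C_A)
    (hU₂ : P₂.IsUniquelySolvable Ω G)
    {g : Space n → ℝ} (hgG : g ∈ G) {u₁ u₂ : SobolevH1 Ω}
    (hu₁ : P₁.IsWeakSolution u₁ g) (hu₂ : P₂.IsWeakSolution u₂ g)
    (hbd : ∀ᵐ x ∂(volume.restrict Ω), g_low ≤ u₁.toFun x ∧ u₁.toFun x ≤ g_up)
    (hb : ∀ x ∈ Ω, ∀ s, P₁.b x s = P₂.b x s) (hc : ∀ x ∈ Ω, ∀ s p, P₁.c x s p = P₂.c x s p)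
    (hne : ¬ FluxesAgreeOn Γ (P₁.flux u₁) (P₂.flux u₂)) :
    ∃ s ∈ Ioo g_low g_up, P₁.a s ≠ P₂.a s := by
  by_contra! heq
  have hΩo := hΩ.isOpen
  have hprinc : ∀ᵐ x ∂(volume.restrict Ω),
      P₁.a (u₁.toFun x) • u₁.grad x = P₂.a (u₁.toFun x) • u₁.grad x := by
    rcases lt_or_ge g_low g_up with hlt | hge
    · have hcl := eqOn_Icc_of_eqOn_Ioo (continuousOn_univ.1 hP₁.a_mem.1)
        (continuousOn_univ.1 hP₂.a_mem.1) hlt heq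
      filter_upwards [hbd] with x hx
      rw [hcl _ hx]
    · -- If the interval `(g_low, g_up)` is empty, `u₁` is constant and its gradient vanishes.
      have hconst : u₁.toFun =ᵐ[volume.restrict Ω] fun _ => g_low :=
        hbd.mono fun x hx => le_antisymm (hx.2.trans hge) hx.1
      have hw : HasWeakFDeriv Ω (fun _ : Space n => g_low) (fun _ => innerSL ℝ (0 : Space n)) := by
        have h := hasWeakFDeriv_of_contDiff (Ω := Ω) (φ := fun _ => g_low) contDiff_const
        have h0 : gradient (fun _ : Space n => g_low) = fun _ => 0 := by
          ext1 x; exact gradient_fun_const x g_low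
        rwa [h0] at h
      have hgrad := ae_eq_of_hasWeakFDeriv hΩo u₁.memLp_grad MemLp.zero' u₁.hasWeakGrad hw hconst
      filter_upwards [hgrad] with x hx
      rw [hx, smul_zero, smul_zero]
  have hflux : ∀ φ, P₁.flux u₁ φ = P₂.flux u₁ φ := Coefficients.flux_congr (by
    filter_upwards [hprinc, ae_restrict_mem hΩo.measurableSet] with x hx hxΩ
    exact ⟨by rw [hx, hb x hxΩ], hc x hxΩ _ _⟩)
  -- As the two fluxes of `u₁` coincide, `u₁` also solves the second problem.
  have hsol : P₂.IsWeakSolution u₁ g := ⟨hu₁.1, fun φ hφ => by rw [← hflux, hu₁.2 φ hφ]⟩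
  have huu := hU₂ g hgG u₁ u₂ hsol hu₂
  have hgg := ae_eq_of_hasWeakFDeriv hΩo u₁.memLp_grad u₂.memLp_grad u₁.hasWeakGrad
    u₂.hasWeakGrad huu
  refine hne fun φ h _ _ => ?_
  rw [hflux]
  exact Coefficients.flux_congr (by
    filter_upwards [huu, hgg] with x h1 h2
    rw [h1, h2]
    exact ⟨rfl, rfl⟩) φ

end QuasilinearElliptic

end

theorem theorem3 (n : ℕ) (hd : n + 1 = 2 ∨ n + 1 = 3)
    (Ω : Set (Space n)) (hΩ : IsBoundedLipschitzDomain Ω)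
    (xbar : Space n) (ε₀ : ℝ) (hflat : IsFlatPart Ω xbar ε₀)
    (g_low g_up : ℝ) :
    ∃ C₀ : ℝ, ∀ (C_G C_A C_U : ℝ) (P₁ P₂ : Coefficients n)
      (u₁ u₂ : (Space n → ℝ) → SobolevH1 Ω),
      P₁.IsAdmissible Ω C_A → P₂.IsAdmissible Ω C_A →
      P₁.IsUniformlySolvable Ω (dirichletClass Ω g_low g_up C_G) C_U →
      P₂.IsUniformlySolvable Ω (dirichletClass Ω g_low g_up C_G) C_U →
      (∀ g ∈ dirichletClass Ω g_low g_up C_G,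
        P₁.IsWeakSolution (u₁ g) g ∧ P₂.IsWeakSolution (u₂ g) g) →
      (C₀ ≤ C_G →
        (∃ s ∈ Ioo g_low g_up, P₁.a s ≠ P₂.a s) →
        ∃ g ∈ dirichletClass Ω g_low g_up C_G,
          ¬ FluxesAgreeOn (accessiblePart Ω xbar ε₀) (P₁.flux (u₁ g)) (P₂.flux (u₂ g))) ∧
      (P₁.IsUniquelySolvable Ω (dirichletClass Ω g_low g_up C_G) →
        P₂.IsUniquelySolvable Ω (dirichletClass Ω g_low g_up C_G) →
        (∀ g ∈ dirichletClass Ω g_low g_up C_G, ∀ᵐ x ∂(volume.restrict Ω),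
          (g_low ≤ (u₁ g).toFun x ∧ (u₁ g).toFun x ≤ g_up) ∧
          (g_low ≤ (u₂ g).toFun x ∧ (u₂ g).toFun x ≤ g_up)) →
        (∀ x ∈ Ω, ∀ s, P₁.b x s = P₂.b x s) →
        (∀ x ∈ Ω, ∀ s p, P₁.c x s p = P₂.c x s p) →
        (∃ g ∈ dirichletClass Ω g_low g_up C_G,
          ¬ FluxesAgreeOn (accessiblePart Ω xbar ε₀) (P₁.flux (u₁ g)) (P₂.flux (u₂ g))) →
        ∃ s ∈ Ioo g_low g_up, P₁.a s ≠ P₂.a s) := by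
  have hn : 1 ≤ n := by omega
  refine ⟨√(max |g_low| |g_up| ^ 2 * (surfaceMeasure Ω).real univ + 1),
    fun C_G C_A C_U P₁ P₂ u₁ u₂ hP₁ hP₂ hS₁ hS₂ hu => ⟨?_, ?_⟩⟩
  · rintro hC ⟨s, hs, hne⟩
    exact exists_not_fluxesAgreeOn hn hΩ hflat hP₁ hP₂ hS₁ hS₂ hu hC hs hne
  · rintro - hU₂ hbd hb hc ⟨g, hg, hne⟩
    exact exists_ne_of_not_fluxesAgreeOn hΩ hP₁ hP₂ hU₂ hg (hu g hg).1 (hu g hg).2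
      ((hbd g hg).mono fun x hx => hx.1) hb hc hne
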